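/- A $\mathbb Z_2$-graded Hilbert space is a pair $(\mathcal H,U)$ of a complex Hilbert space $\mathcal H$ and a self-adjoint unitary $U\in\mathcal B(\mathcal H)$. A vector $x$ is even if $Ux=x$ and odd if $Ux=-x$. For $T\in\mathcal B(\mathcal H)$ put $T_\pm:=\tfrac12(T\pm UTU)$; $T$ is even if $T=T_+$ and odd if $T=T_-$. The twist automorphism of $\mathcal B(\mathcal H)$ is $\eta_U(T):=T_++iUT_-$, and the twisted commutant of a von Neumann algebra $\mathcal M\subset\mathcal B(\mathcal H)$ is $\mathcal M^{\wr}:=\eta_U(\mathcal M')$ (equivalently $\eta_U(\mathcal M)'$). Let $(\mathcal H,U)$ and $(\mathcal K,V)$ be $\mathbb Z_2$-graded Hilbert spaces, and grade the Hilbert space tensor product $\mathcal H\otimes\mathcal K$ by $U\otimes V$. For $S\in\mathcal B(\mathcal H)$ and $T\in\mathcal B(\mathcal K)$, let $S\,\hat\otimes\,T:=S\otimes T_++SU\otimes T_-\in\mathcal B(\mathcal H\otimes\mathcal K)$; thus for homogeneous $T$ and $x$ one has $(S\,\hat\otimes\,T)(x\otimes y)=\varepsilon(T,x)\,Sx\otimes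 Ty$, where $\varepsilon(T,x)=-1$ if $T$ and $x$ are both odd and $\varepsilon(T,x)=1$ otherwise. For von Neumann algebras $\mathcal M\subset\mathcal B(\mathcal H)$ and $\mathcal N\subset\mathcal B(\mathcal K)$, the Fermi product $\mathcal M\,\hat\otimes\,\mathcal N$ is the von Neumann algebra on $\mathcal H\otimes\mathcal K$ generated by all $S\,\hat\otimes\,T$ with $S\in\mathcal M$, $T\in\mathcal N$. Theorem. Let $\mathcal M\subset\mathcal B(\mathcal H)$ and $\mathcal N\subset\mathcal B(\mathcal K)$ be von Neumann algebras on $\mathbb Z_2$-graded Hilbert spaces $(\mathcal H,U)$ and $(\mathcal K,V)$ such that $U\mathcal MU=\mathcal M$ and $V\mathcal NV=\mathcal N$. Then $$(\mathcal M\,\hat\otimes\,\mathcal N)^{\wr}=\mathcal M^{\wr}\,\hat\otimes\,\mathcal N^{\wr},$$ where the twisted commutants are taken with respect to the gradings $U\otimes V$, $U$ and $V$, respectively. -/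

import Mathlib

open scoped TensorProduct

set_option linter.unusedSectionVars false

noncomputable section

namespace FermiProduct

universe u v

/-! ### Gradings, homogeneous parts and the twist -/

section OneSpace

variable {H : Type u} [NormedAddCommGroup H] [InnerProductSpace ℂ H] [CompleteSpace H]

/-- A `ℤ₂`-grading of a Hilbert space `H`: a self-adjoint unitary operator on `H`.
The even (odd) vectors are those with `U ξ = ξ` (with `U ξ = -ξ`). -/
structure Grading (H : Type u) [NormedAddCommGroup H] [InnerProductSpace ℂ H]
    [CompleteSpace H] where
  /-- the grading operator -/
  op : H →L[ℂ] H
  isSelfAdjoint : IsSelfAdjoint op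
  mem_unitary : op ∈ unitary (H →L[ℂ] H)

theorem Grading.op_mul_op (U : Grading H) : U.op * U.op = 1 := by
  have h := (Unitary.mem_iff.mp U.mem_unitary).1
  rwa [U.isSelfAdjoint.star_eq] at h

/-- The even part `T₊ = (T + U T U) / 2` of an operator. -/
def Grading.evenPart (U : Grading H) (T : H →L[ℂ] H) : H →L[ℂ] H :=
  (2⁻¹ : ℂ) • (T + U.op * T * U.op)

/-- The odd part `T₋ = (T - U T U) / 2` of an operator. -/
def Grading.oddPart (U : Grading H) (T : H →L[ℂ] H) : H →L[ℂ] H :=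
  (2⁻¹ : ℂ) • (T - U.op * T * U.op)

/-- The twist automorphism `η_U (T₊ + T₋) = T₊ + i U T₋` of `B(H)`. -/
def Grading.twist (U : Grading H) (T : H →L[ℂ] H) : H →L[ℂ] H :=
  U.evenPart T + Complex.I • (U.op * U.oddPart T)

/-- The von Neumann algebra `M` is invariant under the grading: `U M U = M`. -/
def Grading.Preserves (U : Grading H) (M : VonNeumannAlgebra H) : Prop :=
  (fun T : H →L[ℂ] H => U.op * T * U.op) '' (M : Set (H →L[ℂ] H)) = M

theorem Grading.evenPart_add_oddPart (U : Grading H) (T : H →L[ℂ] H) :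
    U.evenPart T + U.oddPart T = T := by
  unfold Grading.evenPart Grading.oddPart
  module

/-- The unitary `((1 - i) + (1 + i) U) / 2`, which implements the twist. -/
def Grading.twistUnitary (U : Grading H) : unitary (H →L[ℂ] H) :=
  ⟨(2⁻¹ : ℂ) • ((1 - Complex.I) • (1 : H →L[ℂ] H) + (1 + Complex.I) • U.op), by
    have hU := U.op_mul_op
    have hs := U.isSelfAdjoint.star_eq
    rw [Unitary.mem_iff]
    constructor <;>
    · simp only [star_smul, star_add, hs, star_one, Complex.star_def, map_inv₀, map_sub,
        map_one, Complex.conj_I, smul_mul_assoc, mul_smul_comm, add_mul, mul_add, one_mul,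
        mul_one, hU, map_ofNat, sub_neg_eq_add]
      match_scalars <;> first
        | ring1
        | linear_combination -(1 / 2 : ℂ) * Complex.I_mul_I
        | linear_combination (1 / 2 : ℂ) * Complex.I_mul_I⟩

theorem Grading.twist_eq (U : Grading H) (T : H →L[ℂ] H) :
    U.twist T = Unitary.conjStarAlgAut ℂ (H →L[ℂ] H) U.twistUnitary T := by
  have hU := U.op_mul_op
  have hs := U.isSelfAdjoint.star_eq
  have hU' : ∀ X : H →L[ℂ] H, U.op * (U.op * X) = X := fun X => by rw [← mul_assoc, hU, one_mul]
  rw [Unitary.conjStarAlgAut_apply]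
  simp only [Grading.twist, Grading.evenPart, Grading.oddPart, Grading.twistUnitary,
    star_smul, star_add, hs, star_one, Complex.star_def, map_inv₀, map_sub,
    map_one, Complex.conj_I, smul_mul_assoc, mul_smul_comm, add_mul, mul_add, one_mul,
    mul_one, map_ofNat, sub_neg_eq_add, mul_sub, mul_assoc, hU']
  match_scalars <;> first
    | ring1
    | linear_combination (1 / 4 : ℂ) * Complex.I_mul_I
    | linear_combination -(1 / 4 : ℂ) * Complex.I_mul_I

theorem centralizer_image_equiv {A : Type*} [Mul A] (e : A ≃* A) (s : Set A) :
    Set.centralizer (e '' s) = e '' Set.centralizer s := by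
  ext x
  obtain ⟨y, rfl⟩ := e.surjective x
  simp [Set.mem_centralizer_iff, ← map_mul]

theorem Grading.twist_image_commutant (U : Grading H) (M : VonNeumannAlgebra H) :
    U.twist '' (M.commutant : Set (H →L[ℂ] H)) =
      (M.commutant.toStarSubalgebra.map
        (Unitary.conjStarAlgAut ℂ (H →L[ℂ] H) U.twistUnitary).toStarAlgHom :
          StarSubalgebra ℂ (H →L[ℂ] H)) := by
  have h : U.twist = Unitary.conjStarAlgAut ℂ (H →L[ℂ] H) U.twistUnitary := funext U.twist_eq
  rw [h]
  rfl

/-- The twisted commutant `M^≀ = η_U (M')`. -/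
def Grading.twistedCommutant (U : Grading H) (M : VonNeumannAlgebra H) : VonNeumannAlgebra H where
  toStarSubalgebra := StarSubalgebra.copy _ (U.twist '' (M.commutant : Set (H →L[ℂ] H)))
    (U.twist_image_commutant M)
  centralizer_centralizer' := by
    change Set.centralizer (Set.centralizer (U.twist '' (M.commutant : Set (H →L[ℂ] H)))) =
      U.twist '' (M.commutant : Set (H →L[ℂ] H))
    have h : U.twist = Unitary.conjStarAlgAut ℂ (H →L[ℂ] H) U.twistUnitary := funext U.twist_eq
    have hc := centralizer_image_equiv
      (Unitary.conjStarAlgAut ℂ (H →L[ℂ] H) U.twistUnitary).toRingEquiv.toMulEquiv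
    have h1 := hc (Set.centralizer M.commutant)
    rw [← hc, M.commutant.centralizer_centralizer] at h1
    rw [h]
    exact h1

/-- The two descriptions of the twisted commutant agree: `η_U (M') = η_U (M)'`. -/
theorem Grading.coe_twistedCommutant_eq_centralizer (U : Grading H) (M : VonNeumannAlgebra H) :
    (U.twistedCommutant M : Set (H →L[ℂ] H)) = Set.centralizer (U.twist '' M) := by
  have h : U.twist = Unitary.conjStarAlgAut ℂ (H →L[ℂ] H) U.twistUnitary := funext U.twist_eq
  change U.twist '' (M.commutant : Set (H →L[ℂ] H)) = _
  rw [M.coe_commutant, h]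
  exact (centralizer_image_equiv
    (Unitary.conjStarAlgAut ℂ (H →L[ℂ] H) U.twistUnitary).toRingEquiv.toMulEquiv _).symm

/-- The von Neumann algebra generated by a set `S` of operators: `(S ∪ S*)''`. -/
def generated (S : Set (H →L[ℂ] H)) : VonNeumannAlgebra H where
  toStarSubalgebra := StarSubalgebra.centralizer ℂ (Set.centralizer (S ∪ star S))
  centralizer_centralizer' := by
    change Set.centralizer (Set.centralizer
      (StarSubalgebra.centralizer ℂ (Set.centralizer (S ∪ star S)) : Set (H →L[ℂ] H))) =
      (StarSubalgebra.centralizer ℂ (Set.centralizer (S ∪ star S)) : Set (H →L[ℂ] H))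
    rw [StarSubalgebra.coe_centralizer, Set.centralizer_centralizer_centralizer]

/-- `generated S` is the smallest von Neumann algebra that contains `S`. -/
theorem generated_le_iff (S : Set (H →L[ℂ] H)) (M : VonNeumannAlgebra H) :
    generated S ≤ M ↔ S ⊆ (M : Set (H →L[ℂ] H)) := by
  have hc : (generated S : Set (H →L[ℂ] H)) =
      Set.centralizer (Set.centralizer (S ∪ star S)) := by
    change (StarSubalgebra.centralizer ℂ (Set.centralizer (S ∪ star S)) : Set (H →L[ℂ] H)) = _
    rw [StarSubalgebra.coe_centralizer, Set.star_centralizer, Set.union_star, star_star,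
      Set.union_comm (star S) S, Set.union_self]
  rw [← SetLike.coe_subset_coe, hc]
  constructor
  · exact fun h => (Set.subset_union_left.trans Set.subset_centralizer_centralizer).trans h
  · intro h
    rw [← M.centralizer_centralizer]
    refine Set.centralizer_subset (Set.centralizer_subset (Set.union_subset h ?_))
    intro T hT
    have := star_mem (h hT)
    simpa using this

end OneSpace

/-! ### The Fermi product -/

section TwoSpaces

variable {H : Type u} [NormedAddCommGroup H] [InnerProductSpace ℂ H] [CompleteSpace H]
  {K : Type v} [NormedAddCommGroup K] [InnerProductSpace ℂ K] [CompleteSpace K]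

/-- The Hilbert space tensor product: the completion of the algebraic tensor product in the inner
product `⟪x ⊗ y, x' ⊗ y'⟫ = ⟪x, x'⟫ ⟪y, y'⟫`. -/
abbrev HilbertTensor (H : Type u) [NormedAddCommGroup H] [InnerProductSpace ℂ H]
    (K : Type v) [NormedAddCommGroup K] [InnerProductSpace ℂ K] : Type (max u v) :=
  UniformSpace.Completion (H ⊗[ℂ] K)

/-- The simple tensor `x ⊗ y` in the Hilbert space tensor product. -/
def tmul (x : H) (y : K) : HilbertTensor H K :=
  ((x ⊗ₜ[ℂ] y : H ⊗[ℂ] K) : UniformSpace.Completion (H ⊗[ℂ] K))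

/-- The usual tensor product `S ⊗ T` of two bounded operators. -/
def tensorOp (S : H →L[ℂ] H) (T : K →L[ℂ] K) : HilbertTensor H K →L[ℂ] HilbertTensor H K :=
  (TensorProduct.mapL S T).completion

theorem tensorOp_tmul (S : H →L[ℂ] H) (T : K →L[ℂ] K) (x : H) (y : K) :
    tensorOp S T (tmul x y) = tmul (S x) (T y) := by
  simp [tensorOp, tmul]

theorem tensorOp_mul (S S' : H →L[ℂ] H) (T T' : K →L[ℂ] K) :
    tensorOp S T * tensorOp S' T' = tensorOp (S * S') (T * T') := by
  ext x
  induction x using UniformSpace.Completion.induction_on with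
  | hp => exact isClosed_eq (ContinuousLinearMap.continuous _) (ContinuousLinearMap.continuous _)
  | ih x => simp [tensorOp, TensorProduct.mapL_mul, -TensorProduct.mapL_apply]

theorem tensorOp_one_one : tensorOp (1 : H →L[ℂ] H) (1 : K →L[ℂ] K) = 1 := by
  ext x
  induction x using UniformSpace.Completion.induction_on with
  | hp => exact isClosed_eq (ContinuousLinearMap.continuous _) (ContinuousLinearMap.continuous _)
  | ih x => simp [tensorOp, ContinuousLinearMap.one_def]

theorem inner_map_map_of_isSelfAdjoint {S : H →L[ℂ] H} {T : K →L[ℂ] K} (hS : IsSelfAdjoint S)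
    (hT : IsSelfAdjoint T) (x y : H ⊗[ℂ] K) :
    inner ℂ (TensorProduct.mapL S T x) y = inner ℂ x (TensorProduct.mapL S T y) := by
  have hS' : ∀ a b, inner ℂ (S a) b = inner ℂ a (S b) := fun a b => hS.isSymmetric a b
  have hT' : ∀ a b, inner ℂ (T a) b = inner ℂ a (T b) := fun a b => hT.isSymmetric a b
  induction x using TensorProduct.induction_on with
  | zero => simp
  | add x x' hx hx' => rw [map_add, inner_add_left, inner_add_left, hx, hx']
  | tmul a b =>
    induction y using TensorProduct.induction_on with
    | zero => simp
    | add y y' hy hy' => rw [map_add, inner_add_right, inner_add_right, hy, hy']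
    | tmul c d => simp [TensorProduct.inner_tmul, hS', hT']

theorem tensorOp_isSelfAdjoint {S : H →L[ℂ] H} {T : K →L[ℂ] K} (hS : IsSelfAdjoint S)
    (hT : IsSelfAdjoint T) : IsSelfAdjoint (tensorOp S T) := by
  rw [ContinuousLinearMap.isSelfAdjoint_iff_isSymmetric]
  intro x y
  induction x, y using UniformSpace.Completion.induction_on₂ with
  | hp => exact isClosed_eq (by simp; fun_prop) (by simp; fun_prop)
  | ih x y =>
    simpa [tensorOp, -TensorProduct.mapL_apply] using inner_map_map_of_isSelfAdjoint hS hT x y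

/-- The natural grading `U ⊗ V` of the Hilbert space tensor product. -/
def Grading.tensor (U : Grading H) (V : Grading K) : Grading (HilbertTensor H K) where
  op := tensorOp U.op V.op
  isSelfAdjoint := tensorOp_isSelfAdjoint U.isSelfAdjoint V.isSelfAdjoint
  mem_unitary := by
    have h : tensorOp U.op V.op * tensorOp U.op V.op = 1 := by
      rw [tensorOp_mul, U.op_mul_op, V.op_mul_op, tensorOp_one_one]
    rw [Unitary.mem_iff, (tensorOp_isSelfAdjoint U.isSelfAdjoint V.isSelfAdjoint).star_eq]
    exact ⟨h, h⟩

/-- The Fermi product `S ⊗̂ T` of two bounded operators, `S ⊗ T₊ + S U ⊗ T₋`. For homogeneous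
operators and vectors this is `(S ⊗̂ T) (x ⊗ y) = ε(T, x) (S x ⊗ T y)`, with the sign `ε(T, x) = -1`
if `T` and `x` are both odd and `ε(T, x) = 1` otherwise: see the lemmas on `fermiOp` below. -/
def fermiOp (U : Grading H) (V : Grading K) (S : H →L[ℂ] H) (T : K →L[ℂ] K) :
    HilbertTensor H K →L[ℂ] HilbertTensor H K :=
  tensorOp S (V.evenPart T) + tensorOp (S * U.op) (V.oddPart T)

theorem tmul_zero (x : H) : tmul x (0 : K) = 0 := by simp [tmul]

theorem neg_tmul (x : H) (y : K) : tmul (-x) y = -tmul x y := by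
  simp only [tmul, TensorProduct.neg_tmul]
  exact UniformSpace.Completion.coe_neg _

theorem Grading.op_op (U : Grading H) (x : H) : U.op (U.op x) = x :=
  congrArg (fun T : H →L[ℂ] H => T x) U.op_mul_op

theorem Grading.parts_of_even (V : Grading K) {T : K →L[ℂ] K} (hT : V.op * T * V.op = T) :
    V.evenPart T = T ∧ V.oddPart T = 0 := by
  unfold Grading.evenPart Grading.oddPart
  rw [hT]
  constructor <;> module

theorem Grading.parts_of_odd (V : Grading K) {T : K →L[ℂ] K} (hT : V.op * T * V.op = -T) :
    V.evenPart T = 0 ∧ V.oddPart T = T := by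
  unfold Grading.evenPart Grading.oddPart
  rw [hT]
  constructor <;> module

theorem fermiOp_tmul_of_even (U : Grading H) (V : Grading K) (S : H →L[ℂ] H) {T : K →L[ℂ] K}
    (hT : V.op * T * V.op = T) (x : H) (y : K) :
    fermiOp U V S T (tmul x y) = tmul (S x) (T y) := by
  obtain ⟨h₁, h₂⟩ := V.parts_of_even hT
  simp [fermiOp, h₁, h₂, tensorOp_tmul, tmul_zero]

theorem fermiOp_tmul_of_odd (U : Grading H) (V : Grading K) (S : H →L[ℂ] H) {T : K →L[ℂ] K}
    (hT : V.op * T * V.op = -T) (x : H) (y : K) :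
    fermiOp U V S T (tmul x y) = tmul (S (U.op x)) (T y) := by
  obtain ⟨h₁, h₂⟩ := V.parts_of_odd hT
  simp [fermiOp, h₁, h₂, tensorOp_tmul, tmul_zero]

theorem fermiOp_tmul_of_odd_of_even (U : Grading H) (V : Grading K) (S : H →L[ℂ] H)
    {T : K →L[ℂ] K} (hT : V.op * T * V.op = -T) {x : H} (hx : U.op x = x) (y : K) :
    fermiOp U V S T (tmul x y) = tmul (S x) (T y) := by
  rw [fermiOp_tmul_of_odd U V S hT, hx]

theorem fermiOp_tmul_of_odd_of_odd (U : Grading H) (V : Grading K) (S : H →L[ℂ] H)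
    {T : K →L[ℂ] K} (hT : V.op * T * V.op = -T) {x : H} (hx : U.op x = -x) (y : K) :
    fermiOp U V S T (tmul x y) = -tmul (S x) (T y) := by
  rw [fermiOp_tmul_of_odd U V S hT, hx, map_neg, neg_tmul]

/-- The Fermi product `M ⊗̂ N`: the von Neumann algebra on the Hilbert space tensor product
generated by the operators `S ⊗̂ T` with `S ∈ M` and `T ∈ N`. -/
def fermiProduct (U : Grading H) (V : Grading K) (M : VonNeumannAlgebra H)
    (N : VonNeumannAlgebra K) : VonNeumannAlgebra (HilbertTensor H K) :=
  generated {R | ∃ S ∈ M, ∃ T ∈ N, R = fermiOp U V S T}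

end TwoSpaces

end FermiProduct

end

open FermiProduct

/-! ### Operators on the Hilbert space tensor product -/

namespace FermiProduct

section Tensor

variable {H : Type*} [NormedAddCommGroup H] [InnerProductSpace ℂ H] [CompleteSpace H]
  {K : Type*} [NormedAddCommGroup K] [InnerProductSpace ℂ K] [CompleteSpace K]

/-! The twist sends the operators `S₊ ⊗ T + S₋ ⊗ V T` (`untwistedFermiOp`), with `S` in `M'` and `T`
in `N'`, to the generators of the right-hand side. That these operators lie in the commutant of the
Fermi product is a matter of signs. For the other inclusion it suffices that every `X` in that
commutant commutes with every `Y` commuting with all of them. Split `X` by parity under `U ⊗ 1` and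
`Y` by parity under `1 ⊗ V`. Once the odd parts are multiplied by `1 ⊗ V` and `U ⊗ 1` respectively,
the pieces lie in the ordinary commutants of `M ⊗ N` and of `M' ⊗ N'`. These commute by Tomita's
theorem (`commute_of_mem_commutant_tensorAlgebra`), and `commute_of_graded_decomposition`
reassembles the pieces.

Tomita's theorem is proved with real subspaces and bounded operators only. By polarization it is
enough that `⟪Y ω, X ω⟫` is real for self-adjoint `X`, `Y` and `ω = a ⊗ b`. Inside the closure of
`M' a`, the compressed real span of `M_sa a` meets its multiple by `i` only in zero, and its real
orthogonal complement is generated by `i M'_sa a` (`projection_mem_of_mem_realOrbit_orthogonal`,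
which rests on `eq_zero_of_re_im_orbit`); likewise for `N` and `b`. A tensor that is suitably
orthogonal to the products of these spaces and of their complements vanishes
(`eq_zero_of_re_im_tmul`). Hence the compression of `Y ω` is a limit of real combinations of
compressed vectors `m a ⊗ n b` with `m`, `n` self-adjoint, and `X ω` has real inner product with
each of those. -/

theorem inner_tmul_tmul (x x' : H) (y y' : K) :
    inner ℂ (tmul x y) (tmul x' y') = inner ℂ x x' * inner ℂ y y' := by
  simp [tmul, TensorProduct.inner_tmul]

/-- The simple tensors as a bounded bilinear map. -/
noncomputable def tmulL (H : Type*) [NormedAddCommGroup H] [InnerProductSpace ℂ H]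
    (K : Type*) [NormedAddCommGroup K] [InnerProductSpace ℂ K] :
    H →L[ℂ] K →L[ℂ] HilbertTensor H K :=
  LinearMap.mkContinuous₂ (LinearMap.mk₂ ℂ tmul
    (fun x x' y => by
      simp only [tmul, TensorProduct.add_tmul]; exact UniformSpace.Completion.coe_add _ _)
    (fun c x y => by
      simp only [tmul, ← TensorProduct.smul_tmul']; exact UniformSpace.Completion.coe_smul _ _)
    (fun x y y' => by
      simp only [tmul, TensorProduct.tmul_add]; exact UniformSpace.Completion.coe_add _ _)
    (fun c x y => by
      simp only [tmul, TensorProduct.tmul_smul]; exact UniformSpace.Completion.coe_smul _ _))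
    1 (fun x y => by simp [tmul, TensorProduct.norm_tmul])

theorem tmulL_apply (x : H) (y : K) : tmulL H K x y = tmul x y := rfl

theorem tensor_induction {p : HilbertTensor H K → Prop} (ζ : HilbertTensor H K)
    (hp : IsClosed {ζ | p ζ}) (h0 : p 0) (htmul : ∀ x y, p (tmul x y))
    (hadd : ∀ a b, p a → p b → p (a + b)) : p ζ := by
  induction ζ using UniformSpace.Completion.induction_on with
  | hp => exact hp
  | ih z =>
    induction z using TensorProduct.induction_on with
    | zero => rwa [UniformSpace.Completion.coe_zero]
    | tmul x y => exact htmul x y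
    | add a b ha hb => rw [UniformSpace.Completion.coe_add]; exact hadd _ _ ha hb

theorem eq_zero_of_inner_tmul {ζ : HilbertTensor H K}
    (h : ∀ x y, inner ℂ ζ (tmul x y) = 0) : ζ = 0 := by
  refine ext_inner_right ℂ fun ξ => ?_
  rw [inner_zero_left]
  refine tensor_induction ξ (isClosed_eq (by fun_prop) continuous_const) (by simp) h ?_
  intro a b ha hb
  rw [inner_add_right, ha, hb, add_zero]

theorem tensor_op_ext {A B : HilbertTensor H K →L[ℂ] HilbertTensor H K}
    (h : ∀ x y, A (tmul x y) = B (tmul x y)) : A = B := by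
  ext ζ
  refine tensor_induction ζ (isClosed_eq (by fun_prop) (by fun_prop)) (by simp) h ?_
  intro a b ha hb
  rw [map_add, map_add, ha, hb]

theorem star_tensorOp (S : H →L[ℂ] H) (T : K →L[ℂ] K) :
    star (tensorOp S T) = tensorOp (star S) (star T) := by
  refine tensor_op_ext fun x y => ?_
  rw [← sub_eq_zero]
  refine eq_zero_of_inner_tmul fun x' y' => ?_
  rw [inner_sub_left, ContinuousLinearMap.star_eq_adjoint,
    ContinuousLinearMap.adjoint_inner_left, tensorOp_tmul, tensorOp_tmul, inner_tmul_tmul,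
    inner_tmul_tmul, ContinuousLinearMap.star_eq_adjoint, ContinuousLinearMap.star_eq_adjoint,
    ContinuousLinearMap.adjoint_inner_left, ContinuousLinearMap.adjoint_inner_left, sub_self]

theorem tensorOp_add_left (S S' : H →L[ℂ] H) (T : K →L[ℂ] K) :
    tensorOp (S + S') T = tensorOp S T + tensorOp S' T :=
  tensor_op_ext fun x y => by
    simp [tensorOp_tmul]; simp [← tmulL_apply]

theorem tensorOp_add_right (S : H →L[ℂ] H) (T T' : K →L[ℂ] K) :
    tensorOp S (T + T') = tensorOp S T + tensorOp S T' :=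
  tensor_op_ext fun x y => by
    simp [tensorOp_tmul]; simp [← tmulL_apply]

theorem tensorOp_smul_left (c : ℂ) (S : H →L[ℂ] H) (T : K →L[ℂ] K) :
    tensorOp (c • S) T = c • tensorOp S T :=
  tensor_op_ext fun x y => by
    simp [tensorOp_tmul]; simp [← tmulL_apply]

theorem tensorOp_smul_right (c : ℂ) (S : H →L[ℂ] H) (T : K →L[ℂ] K) :
    tensorOp S (c • T) = c • tensorOp S T :=
  tensor_op_ext fun x y => by
    simp [tensorOp_tmul]; simp [← tmulL_apply]

/-- Neither contraction can shrink the vector, so `‖A ζ‖ = ‖ζ‖`, and `‖A² ζ - ζ‖² = ‖A² ζ‖² - 2 ‖A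
ζ‖² + ‖ζ‖² ≤ 0`. -/
theorem apply_apply_eq_self_of_mul_eq_neg {G : Type*} [NormedAddCommGroup G] [InnerProductSpace ℂ G]
    [CompleteSpace G] {A B : G →L[ℂ] G} (hA : IsSelfAdjoint A) (hA1 : ‖A‖ ≤ 1) (hB1 : ‖B‖ ≤ 1)
    {ζ : G} (h : B (A ζ) = -ζ) : A (A ζ) = ζ := by
  have h1 : ‖ζ‖ ≤ ‖A ζ‖ := by
    rw [← norm_neg, ← h]; exact B.le_of_opNorm_le hB1 _ |>.trans (by simp)
  have h2 : ‖A (A ζ)‖ ≤ ‖A ζ‖ := (A.le_of_opNorm_le hA1 _).trans (by simp)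
  have h3 : ‖A ζ‖ ≤ ‖ζ‖ := (A.le_of_opNorm_le hA1 _).trans (by simp)
  have h4 : RCLike.re (inner ℂ (A (A ζ)) ζ) = ‖A ζ‖ ^ 2 := by
    have := hA.isSymmetric (A ζ) ζ
    simp only [ContinuousLinearMap.coe_coe] at this
    rw [this, inner_self_eq_norm_sq]
  have h5 := norm_sub_sq (𝕜 := ℂ) (A (A ζ)) ζ
  rw [h4] at h5
  have h6 : ‖A (A ζ) - ζ‖ ^ 2 ≤ 0 := by
    have := pow_le_pow_left₀ (norm_nonneg _) h1 2
    have := pow_le_pow_left₀ (norm_nonneg _) h2 2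
    linarith
  have : ‖A (A ζ) - ζ‖ = 0 := by nlinarith [norm_nonneg (A (A ζ) - ζ)]
  exact sub_eq_zero.mp (norm_eq_zero.mp this)

theorem norm_tensorOp_le (S : H →L[ℂ] H) (T : K →L[ℂ] K) : ‖tensorOp S T‖ ≤ ‖S‖ * ‖T‖ := by
  refine ContinuousLinearMap.opNorm_le_bound _ (by positivity) fun ζ => ?_
  induction ζ using UniformSpace.Completion.induction_on with
  | hp => exact isClosed_le (by fun_prop) (by fun_prop)
  | ih z =>
    simpa [tensorOp, -TensorProduct.mapL_apply] using
      ContinuousLinearMap.le_of_opNorm_le _ (TensorProduct.norm_mapL_le S T) z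

end Tensor

/-! ### Real subspaces and the complex-linear parts of their reflections. -/

section RealSubspace

variable {H : Type*} [NormedAddCommGroup H] [InnerProductSpace ℂ H] [CompleteSpace H]
  {K : Type*} [NormedAddCommGroup K] [InnerProductSpace ℂ K] [CompleteSpace K]

/-- The imaginary part is recovered from `Im F x = -Re F (i x)`. -/
theorem inner_eq_of_re {F G : H → ℂ} (hF : ∀ x, F (Complex.I • x) = Complex.I * F x)
    (hG : ∀ x, G (Complex.I • x) = Complex.I * G x) (h : ∀ x, (F x).re = (G x).re) (x : H) :
    F x = G x := by
  refine Complex.ext (h x) ?_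
  have := h (Complex.I • x)
  rw [hF, hG] at this
  simpa using this

attribute [local instance] InnerProductSpace.complexToReal

variable (R : Submodule ℝ H) [R.HasOrthogonalProjection]

/-- The complex-linear part of the reflection in a closed real subspace. -/
noncomputable def complexReflection : H →L[ℂ] H where
  toFun x := R.starProjection x - Complex.I • R.starProjection (Complex.I • x) - x
  map_add' x y := by
    simp only [smul_add, map_add]; abel
  map_smul' c x := by
    have hr : ∀ (r : ℝ) (y : H), R.starProjection ((r : ℂ) • y) =
        (r : ℂ) • R.starProjection y := fun r y => by
      rw [Complex.coe_smul, map_smul, Complex.coe_smul]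
    have h1 : R.starProjection (c • x) =
        (c.re : ℂ) • R.starProjection x + (c.im : ℂ) • R.starProjection (Complex.I • x) := by
      rw [← hr, ← hr, ← map_add, smul_smul, ← add_smul, Complex.re_add_im]
    have h2 : R.starProjection (Complex.I • c • x) =
        (c.re : ℂ) • R.starProjection (Complex.I • x) - (c.im : ℂ) • R.starProjection x := by
      rw [← hr, ← hr, ← map_sub, smul_smul, smul_smul, ← sub_smul]
      congr 2
      apply Complex.ext <;> simp
    rw [h1, h2, RingHom.id_apply]
    have hc := (Complex.re_add_im c).symm
    generalize (c.re : ℂ) = r at hc ⊢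
    generalize (c.im : ℂ) = s at hc ⊢
    subst hc
    match_scalars
    · ring
    · linear_combination s * Complex.I_mul_I
    · ring
  cont := by fun_prop

theorem complexReflection_apply (x : H) : complexReflection R x =
    R.starProjection x - Complex.I • R.starProjection (Complex.I • x) - x := rfl

theorem norm_complexReflection_le : ‖complexReflection R‖ ≤ 1 := by
  refine ContinuousLinearMap.opNorm_le_bound _ zero_le_one fun x => ?_
  have h : complexReflection R x =
      (2⁻¹ : ℂ) • (R.reflection x - Complex.I • R.reflection (Complex.I • x)) := by
    rw [complexReflection_apply, R.reflection_apply, R.reflection_apply]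
    match_scalars <;> first
      | norm_num; done
      | ring1
  rw [h, norm_smul]
  have := norm_sub_le (R.reflection x) (Complex.I • R.reflection (Complex.I • x))
  rw [norm_smul, LinearIsometryEquiv.norm_map, LinearIsometryEquiv.norm_map, norm_smul] at this
  simp at this ⊢
  linarith

theorem isSelfAdjoint_complexReflection : IsSelfAdjoint (complexReflection R) := by
  rw [ContinuousLinearMap.isSelfAdjoint_iff_isSymmetric]
  intro x y
  simp only [ContinuousLinearMap.coe_coe]
  refine inner_eq_of_re (F := fun y => inner ℂ (complexReflection R x) y)
    (G := fun y => inner ℂ x (complexReflection R y)) (by simp)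
    (by simp) (fun y => ?_) y
  have hp : ∀ a b, (inner ℂ (R.starProjection a) b).re = (inner ℂ a (R.starProjection b)).re :=
    fun a b => R.inner_starProjection_left_eq_right a b
  have hI : ∀ a b : H, (inner ℂ (Complex.I • a) b).re = -(inner ℂ a (Complex.I • b)).re :=
    fun a b => by simp
  simp only [complexReflection_apply, inner_sub_left, inner_sub_right, Complex.sub_re, hp, hI]
  have := hI x (R.starProjection (Complex.I • y))
  linarith

/-- With `P` the real projection and `S` the operator, `Re ⟪S x, x⟫ = ‖P x‖² + ‖P (i x)‖² - ‖x‖²`.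
For a fixed vector both projections must preserve the norm, which puts `x` and `i x` in `R`. -/
theorem complexReflection_injective (h : ∀ x ∈ R, Complex.I • x ∈ R → x = 0) {x : H}
    (hx : complexReflection R x = x) : x = 0 := by
  have h1 : (inner ℂ (complexReflection R x) x).re = ‖x‖ ^ 2 := by
    rw [hx]; exact inner_self_eq_norm_sq (𝕜 := ℂ) x
  have h2 : (inner ℂ (complexReflection R x) x).re =
      ‖R.starProjection x‖ ^ 2 + ‖R.starProjection (Complex.I • x)‖ ^ 2 - ‖x‖ ^ 2 := by
    have e1 : (inner ℂ (R.starProjection x) x).re = ‖R.starProjection x‖ ^ 2 :=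
      R.re_inner_starProjection_eq_normSq x
    have e2 : (inner ℂ (R.starProjection (Complex.I • x)) (Complex.I • x)).re =
        ‖R.starProjection (Complex.I • x)‖ ^ 2 :=
      R.re_inner_starProjection_eq_normSq _
    have e3 : (inner ℂ x x).re = ‖x‖ ^ 2 := inner_self_eq_norm_sq (𝕜 := ℂ) x
    rw [complexReflection_apply, inner_sub_left, inner_sub_left, Complex.sub_re, Complex.sub_re,
      e1, e3, ← e2]
    simp [inner_smul_left]
    ring
  have h3 := R.norm_starProjection_apply_le x
  have h4 := R.norm_starProjection_apply_le (Complex.I • x)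
  have h5 : ‖Complex.I • x‖ = ‖x‖ := by simp [norm_smul]
  have h6 : ‖R.starProjection x‖ = ‖x‖ := by
    rw [h5] at h4
    nlinarith [norm_nonneg (R.starProjection x), norm_nonneg (R.starProjection (Complex.I • x))]
  have h7 : ‖R.starProjection (Complex.I • x)‖ = ‖Complex.I • x‖ := by
    rw [h5] at h4 ⊢
    nlinarith [norm_nonneg (R.starProjection x), norm_nonneg (R.starProjection (Complex.I • x))]
  exact h x ((R.mem_iff_norm_starProjection x).mpr h6)
    ((R.mem_iff_norm_starProjection _).mpr h7)

/-- If a self-adjoint operator `S` has no fixed vectors, a functional that vanishes on the range of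
`S - 1` is zero. -/
theorem eq_zero_of_apply_sub_self {S : H →L[ℂ] H} (hS : IsSelfAdjoint S)
    (hinj : ∀ x, S x = x → x = 0) (φ : H →L[ℂ] ℂ) (hφ : ∀ x, φ (S x - x) = 0) : φ = 0 := by
  obtain ⟨y, rfl⟩ := (InnerProductSpace.toDual ℂ H).surjective φ
  simp only [InnerProductSpace.toDual_apply_apply] at hφ
  have : S y = y := by
    refine ext_inner_right ℂ fun x => ?_
    have h1 := hS.isSymmetric y x
    have h2 := hφ x
    rw [inner_sub_right] at h2
    simp only [ContinuousLinearMap.coe_coe] at h1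
    rw [h1, sub_eq_zero.mp h2]
  rw [hinj y this, map_zero]

/-- Real-orthogonality to a pair of product sets determines a vector of a tensor product. -/
theorem eq_zero_of_re_im_tmul (Q : Submodule ℝ K) [Q.HasOrthogonalProjection]
    (hR : ∀ x ∈ R, Complex.I • x ∈ R → x = 0) (hQ : ∀ x ∈ Q, Complex.I • x ∈ Q → x = 0)
    {ζ : HilbertTensor H K}
    (hre : ∀ x ∈ R, ∀ y ∈ Q, (inner ℂ ζ (tmul x y)).re = 0)
    (him : ∀ x ∈ Rᗮ, ∀ y ∈ Qᗮ, (inner ℂ ζ (tmul x y)).im = 0) : ζ = 0 := by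
  set S := complexReflection R
  set T := complexReflection Q
  let f : H →L[ℂ] K →L[ℂ] ℂ :=
    (ContinuousLinearMap.compL ℂ K (HilbertTensor H K) ℂ (innerSL ℂ ζ)).comp (tmulL H K)
  have hf : ∀ x y, f x y = inner ℂ ζ (tmul x y) := fun x y => rfl
  -- Let `P`, `P'` be the projections onto `R`, `Q`. Then `f (S x) (T y) + f x y` is the sum of the
  -- values of `f` at `(P x, P' y)`, `(i P (i x), i P' (i y))`, `(x + i P (i x), y - P' y)` and `(x
  -- - P x, y + i P' (i y))`. Since `x + i P (i x) = -i (i x - P (i x))`, the facts `a1` to `a4` say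
  -- that each has real part zero.
  have key_re : ∀ x y, (f (S x) (T y)).re = (-f x y).re := by
    intro x y
    have a1 : (f (R.starProjection x) (Q.starProjection y)).re = 0 :=
      hre _ (R.starProjection_apply_mem x) _ (Q.starProjection_apply_mem y)
    have a2 : (f (R.starProjection (Complex.I • x)) (Q.starProjection (Complex.I • y))).re = 0 :=
      hre _ (R.starProjection_apply_mem _) _ (Q.starProjection_apply_mem _)
    have a3 : (f (Complex.I • x - R.starProjection (Complex.I • x))
        (y - Q.starProjection y)).im = 0 :=
      him _ (R.sub_starProjection_mem_orthogonal _) _ (Q.sub_starProjection_mem_orthogonal _)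
    have a4 : (f (x - R.starProjection x)
        (Complex.I • y - Q.starProjection (Complex.I • y))).im = 0 :=
      him _ (R.sub_starProjection_mem_orthogonal _) _ (Q.sub_starProjection_mem_orthogonal _)
    simp only [S, T, complexReflection_apply]
    simp only [map_sub, map_smul, sub_apply, smul_apply,
      smul_eq_mul, Complex.sub_re, Complex.sub_im, Complex.mul_re, Complex.mul_im, Complex.I_re,
      Complex.I_im, Complex.neg_re] at a1 a2 a3 a4 ⊢
    linarith
  have key : ∀ x y, f (S x) (T y) = -f x y := fun x y =>
    inner_eq_of_re (F := fun x => f (S x) (T y)) (G := fun x => -f x y) (by simp) (by simp)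
      (fun x => key_re x y) x
  have hS : IsSelfAdjoint S := isSelfAdjoint_complexReflection R
  have hT : IsSelfAdjoint T := isSelfAdjoint_complexReflection Q
  have hsymm : ∀ {A : H →L[ℂ] H} {B : K →L[ℂ] K}, IsSelfAdjoint A → IsSelfAdjoint B →
      ∀ x y, inner ℂ (tensorOp A B ζ) (tmul x y) = f (A x) (B y) := by
    intro A B hA hB x y
    have := (tensorOp_isSelfAdjoint hA hB).isSymmetric ζ (tmul x y)
    simp only [ContinuousLinearMap.coe_coe] at this
    rw [this, tensorOp_tmul, hf]
  have hST : tensorOp S T ζ = -ζ := by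
    rw [← sub_eq_zero]
    refine eq_zero_of_inner_tmul fun x y => ?_
    rw [inner_sub_left, hsymm hS hT, key, inner_neg_left, hf, sub_self]
  have h1H : IsSelfAdjoint (1 : H →L[ℂ] H) := IsSelfAdjoint.one _
  have h1K : IsSelfAdjoint (1 : K →L[ℂ] K) := IsSelfAdjoint.one _
  have n1 : ‖tensorOp S (1 : K →L[ℂ] K)‖ ≤ 1 := (norm_tensorOp_le _ _).trans
    (mul_le_one₀ (norm_complexReflection_le R) (norm_nonneg _) ContinuousLinearMap.norm_id_le)
  have n2 : ‖tensorOp (1 : H →L[ℂ] H) T‖ ≤ 1 := (norm_tensorOp_le _ _).trans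
    (mul_le_one₀ ContinuousLinearMap.norm_id_le (norm_nonneg _) (norm_complexReflection_le Q))
  have s1 : tensorOp S 1 (tensorOp S 1 ζ) = ζ :=
    apply_apply_eq_self_of_mul_eq_neg (tensorOp_isSelfAdjoint hS h1K) n1 n2 (by
      rw [← mul_apply_eq_comp, tensorOp_mul, one_mul, mul_one, hST])
  have s2 : tensorOp 1 T (tensorOp 1 T ζ) = ζ :=
    apply_apply_eq_self_of_mul_eq_neg (tensorOp_isSelfAdjoint h1H hT) n2 n1 (by
      rw [← mul_apply_eq_comp, tensorOp_mul, one_mul, mul_one, hST])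
  have t1 : ∀ x y, f (S (S x)) y = f x y := by
    intro x y
    have s1' : tensorOp (S * S) 1 ζ = ζ := by
      rw [← one_mul (1 : K →L[ℂ] K), ← tensorOp_mul, mul_apply_eq_comp, s1]
    rw [hf x y, ← s1', hsymm (by simpa [sq] using hS.pow 2) h1K]
    rfl
  have t2 : ∀ x y, f x (T (T y)) = f x y := by
    intro x y
    have s2' : tensorOp 1 (T * T) ζ = ζ := by
      rw [← one_mul (1 : H →L[ℂ] H), ← tensorOp_mul, mul_apply_eq_comp, s2]
    rw [hf x y, ← s2', hsymm h1H (by simpa [sq] using hT.pow 2)]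
    rfl
  -- As `S²` acts trivially inside `f`, the functional `f (S ·) y + f · y` vanishes on the range of
  -- `S - 1`. Together with `u2` this makes `f (S x) (T y)` equal to `f x y`, while `key` makes it
  -- `-f x y`.
  have u1 : ∀ x y, f (S x) y = -f x y := by
    intro x y
    have := eq_zero_of_apply_sub_self hS (fun x => complexReflection_injective R hR)
      ((f.flip y).comp S + f.flip y) (fun x => by simp [t1])
    have := congrArg (fun φ : H →L[ℂ] ℂ => φ x) this
    simp at this
    linear_combination this
  have u2 : ∀ x y, f x (T y) = -f x y := by
    intro x y
    have := eq_zero_of_apply_sub_self hT (fun x => complexReflection_injective Q hQ)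
      ((f x).comp T + f x) (fun x => by simp [t2])
    have := congrArg (fun φ : K →L[ℂ] ℂ => φ y) this
    simp at this
    linear_combination this
  refine eq_zero_of_inner_tmul fun x y => ?_
  have := key x y
  rw [u1, u2, neg_neg, hf] at this
  exact self_eq_neg.mp this

end RealSubspace

end FermiProduct

namespace FermiProduct

/-! ### Real spans, and von Neumann algebras acting on a vector. -/

section Commutation

variable {H : Type*} [NormedAddCommGroup H] [InnerProductSpace ℂ H] [CompleteSpace H]
  {K : Type*} [NormedAddCommGroup K] [InnerProductSpace ℂ K] [CompleteSpace K]

attribute [local instance] InnerProductSpace.complexToReal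

theorem closure_span_induction {s : Set H} {p : H → Prop} (hp : IsClosed {x | p x})
    (h0 : p 0) (hs : ∀ x ∈ s, p x) (hadd : ∀ x y, p x → p y → p (x + y))
    (hsmul : ∀ (r : ℝ) x, p x → p (r • x)) {x : H}
    (hx : x ∈ (Submodule.span ℝ s).topologicalClosure) : p x := by
  have h : (Submodule.span ℝ s : Set H) ⊆ {x | p x} := fun y hy => by
    induction hy using Submodule.span_induction with
    | mem x h => exact hs x h
    | zero => exact h0
    | add x y _ _ hx hy => exact hadd x y hx hy
    | smul a x _ hx => exact hsmul a x hx
  exact closure_minimal h hp hx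

theorem mem_closure_span {s : Set H} {x : H} (hx : x ∈ s) :
    x ∈ (Submodule.span ℝ s).topologicalClosure :=
  Submodule.le_topologicalClosure _ (Submodule.subset_span hx)

theorem im_inner_eq_zero_of_closure_span {s : Set H} {z : H}
    (hs : ∀ x ∈ s, (inner ℂ x z).im = 0) {x : H}
    (hx : x ∈ (Submodule.span ℝ s).topologicalClosure) : (inner ℂ x z).im = 0 := by
  refine closure_span_induction (p := fun x => (inner ℂ x z).im = 0)
    (isClosed_eq (by fun_prop) continuous_const) (by simp) hs ?_ ?_ hx
  · intro x y hx hy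
    rw [inner_add_left, Complex.add_im, hx, hy, add_zero]
  · intro r x hx
    rw [← Complex.coe_smul, inner_smul_left]
    simp [hx]

/-- The vector `d` is the real-orthogonal projection of `y` onto the closed real span of `D`;
reality of inner products with a fixed `z` passes to that span. -/
theorem exists_real_projection (D : Set H) (y : H) :
    ∃ d, (∀ k ∈ D, (inner ℂ (y - d) k).re = 0) ∧
      ∀ z, (∀ k ∈ D, (inner ℂ k z).im = 0) → (inner ℂ d z).im = 0 := by
  let R := (Submodule.span ℝ D).topologicalClosure
  have : CompleteSpace R := (Submodule.isClosed_topologicalClosure _).completeSpace_coe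
  refine ⟨R.starProjection y, fun k hk => ?_, fun z hz => ?_⟩
  · exact R.starProjection_inner_eq_zero y k (mem_closure_span hk)
  · exact im_inner_eq_zero_of_closure_span hz (R.starProjection_apply_mem y)

/-- The inner product is `⟪ω, A B ω⟫`, and a product of commuting self-adjoint operators is
self-adjoint. -/
theorem im_inner_apply_apply {A B : H →L[ℂ] H} (hA : IsSelfAdjoint A) (hB : IsSelfAdjoint B)
    (hAB : A * B = B * A) (ω : H) : (inner ℂ (A ω) (B ω)).im = 0 := by
  have h1 : inner ℂ (A ω) (B ω) = inner ℂ ω (A (B ω)) := hA.isSymmetric ω (B ω)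
  have h2 : inner ℂ (B ω) (A ω) = inner ℂ ω (B (A ω)) := hB.isSymmetric ω (A ω)
  rw [← mul_apply_eq_comp, hAB, mul_apply_eq_comp, ← h2, ← inner_conj_symm] at h1
  have := congrArg Complex.im h1
  rw [Complex.conj_im] at this
  rw [← inner_conj_symm, Complex.conj_im]
  linarith

theorem inner_apply_of_isSelfAdjoint {A : H →L[ℂ] H} (hA : IsSelfAdjoint A) (x y : H) :
    inner ℂ (A x) y = inner ℂ x (A y) := hA.isSymmetric x y

theorem smul_mem_vonNeumannAlgebra (M : VonNeumannAlgebra H) (c : ℂ) {a : H →L[ℂ] H}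
    (ha : a ∈ M) : c • a ∈ M := M.toStarSubalgebra.smul_mem ha c

theorem exists_selfAdjoint_add_smul_selfAdjoint (M : VonNeumannAlgebra H) {a : H →L[ℂ] H}
    (ha : a ∈ M) : ∃ b ∈ M, ∃ c ∈ M, IsSelfAdjoint b ∧ IsSelfAdjoint c ∧
      a = b + Complex.I • c := by
  refine ⟨(2⁻¹ : ℂ) • (a + star a), smul_mem_vonNeumannAlgebra M _ (add_mem ha (star_mem ha)),
    (2⁻¹ * -Complex.I : ℂ) • (a - star a),
    smul_mem_vonNeumannAlgebra M _ (sub_mem ha (star_mem ha)), ?_, ?_, ?_⟩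
  · simp [IsSelfAdjoint, add_comm]
  · rw [IsSelfAdjoint, star_smul]
    simp only [star_sub, star_star, Complex.star_def, map_mul, map_neg, map_inv₀, map_ofNat,
      Complex.conj_I]
    module
  · match_scalars
    · linear_combination (1 / 2 : ℂ) * Complex.I_mul_I
    · linear_combination (-1 / 2 : ℂ) * Complex.I_mul_I

/-- The closure of `M' ω`. -/
noncomputable def commutantOrbit (M : VonNeumannAlgebra H) (ω : H) : Submodule ℂ H :=
  (Submodule.map (ContinuousLinearMap.apply ℂ H ω).toLinearMap
    (Subalgebra.toSubmodule M.commutant.toStarSubalgebra.toSubalgebra)).topologicalClosure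

theorem commutantOrbit_induction {M : VonNeumannAlgebra H} {ω : H} {p : H → Prop}
    (hp : IsClosed {x | p x}) (h : ∀ m ∈ M.commutant, p (m ω)) {x : H}
    (hx : x ∈ commutantOrbit M ω) : p x :=
  closure_minimal (by rintro _ ⟨m, hm, rfl⟩; exact h m hm) hp hx

theorem apply_mem_commutantOrbit (M : VonNeumannAlgebra H) (ω : H) {m : H →L[ℂ] H}
    (hm : m ∈ M.commutant) : m ω ∈ commutantOrbit M ω :=
  Submodule.le_topologicalClosure _ ⟨m, hm, rfl⟩

theorem self_mem_commutantOrbit (M : VonNeumannAlgebra H) (ω : H) : ω ∈ commutantOrbit M ω :=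
  apply_mem_commutantOrbit M ω (one_mem _)

theorem commutantOrbit_invariant {M : VonNeumannAlgebra H} {ω : H} {m : H →L[ℂ] H}
    (hm : m ∈ M.commutant) {x : H} (hx : x ∈ commutantOrbit M ω) :
    m x ∈ commutantOrbit M ω :=
  commutantOrbit_induction (p := fun x => m x ∈ commutantOrbit M ω)
    ((Submodule.isClosed_topologicalClosure _).preimage m.continuous)
    (fun _ hn => apply_mem_commutantOrbit M ω (mul_mem hm hn)) hx

instance (M : VonNeumannAlgebra H) (ω : H) : CompleteSpace (commutantOrbit M ω) :=
  (Submodule.isClosed_topologicalClosure _).completeSpace_coe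

theorem mem_of_commute_commutant {M : VonNeumannAlgebra H} {v : H →L[ℂ] H}
    (h : ∀ m ∈ M.commutant, ∀ x, m (v x) = v (m x)) : v ∈ M := by
  rw [← M.commutant_commutant, VonNeumannAlgebra.mem_commutant_iff]
  exact fun m hm => ContinuousLinearMap.ext fun x => h m hm x

theorem commutantOrbit_orthogonal_invariant {M : VonNeumannAlgebra H} {ω : H} {m : H →L[ℂ] H}
    (hm : m ∈ M.commutant) {x : H} (hx : x ∈ (commutantOrbit M ω).orthogonal) :
    m x ∈ (commutantOrbit M ω).orthogonal := by
  rw [Submodule.mem_orthogonal] at hx ⊢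
  intro u hu
  rw [← ContinuousLinearMap.adjoint_inner_left]
  exact hx _ (commutantOrbit_invariant (star_mem hm) hu)

/-- An operator defined on the closure of `M' η` that commutes with `M'`, extended by zero to the
orthogonal complement, belongs to `M`. -/
theorem comp_projection_mem {M : VonNeumannAlgebra H} {η : H} (g : commutantOrbit M η →L[ℂ] H)
    (hg : ∀ m (hm : m ∈ M.commutant), ∀ n (hn : n ∈ M.commutant),
      m (g ⟨n η, apply_mem_commutantOrbit M η hn⟩) =
        g ⟨m (n η), apply_mem_commutantOrbit M η (mul_mem hm hn)⟩) :
    g ∘L (commutantOrbit M η).orthogonalProjectionOnto ∈ M := by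
  let E := commutantOrbit M η
  have hP : ∀ x (hx : x ∈ E), E.orthogonalProjectionOnto x = ⟨x, hx⟩ := fun x hx =>
    E.orthogonalProjectionOnto_mem_subspace_eq_self ⟨x, hx⟩
  refine mem_of_commute_commutant fun m hm x => ?_
  simp only [ContinuousLinearMap.comp_apply]
  have h1 : ∀ x ∈ E, m (g (E.orthogonalProjectionOnto x)) = g (E.orthogonalProjectionOnto (m x)) :=
    fun x hx => commutantOrbit_induction
      (p := fun x => m (g (E.orthogonalProjectionOnto x)) = g (E.orthogonalProjectionOnto (m x)))
      (isClosed_eq (by fun_prop) (by fun_prop))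
      (fun n hn => by
        rw [hP _ (apply_mem_commutantOrbit M η hn), hg m hm n hn]
        exact congrArg g (hP _ (apply_mem_commutantOrbit M η (mul_mem hm hn))).symm) hx
  have h2 : ∀ x ∈ E.orthogonal,
      m (g (E.orthogonalProjectionOnto x)) = g (E.orthogonalProjectionOnto (m x)) := by
    intro x hx
    rw [Submodule.orthogonalProjectionOnto_eq_zero_iff.mpr hx,
      Submodule.orthogonalProjectionOnto_eq_zero_iff.mpr
        (commutantOrbit_orthogonal_invariant hm hx), map_zero, map_zero]
  have h3 := congrArg₂ (· + ·) (h1 _ (E.starProjection_apply_mem x))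
    (h2 _ (E.sub_starProjection_mem_orthogonal x))
  simpa only [← map_add, add_sub_cancel] using h3

/-- The inclusion of the orbit closure intertwines `M'`. Compressing by this projection replaces any
assumption that `ω` is cyclic for `M'`. -/
theorem starProjection_commutantOrbit_mem (M : VonNeumannAlgebra H) (ω : H) :
    (commutantOrbit M ω).starProjection ∈ M :=
  comp_projection_mem (commutantOrbit M ω).subtypeL (fun _ _ _ _ => rfl)

/-- Vectors that `M'` cannot distinguish are related by a contraction in `M`. -/
theorem exists_contraction_mem {M : VonNeumannAlgebra H} {η ζ : H}
    (h : ∀ m ∈ M.commutant, ‖m ζ‖ = ‖m η‖) :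
    ∃ v ∈ M, (∀ x, ‖v x‖ ≤ ‖x‖) ∧ v η = ζ := by
  let A := Subalgebra.toSubmodule M.commutant.toStarSubalgebra.toSubalgebra
  -- The contraction sends `m η` to `m ζ`. The norm hypothesis makes this well defined and isometric
  -- on the dense orbit `M' η`.
  let e : A →ₗ[ℂ] commutantOrbit M η := LinearMap.codRestrict _
    ((ContinuousLinearMap.apply ℂ H η).toLinearMap ∘ₗ A.subtype)
    (fun a => apply_mem_commutantOrbit M η a.2)
  let f : A →ₗ[ℂ] H := (ContinuousLinearMap.apply ℂ H ζ).toLinearMap ∘ₗ A.subtype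
  have he : DenseRange e := by
    intro x
    rw [Topology.IsInducing.subtypeVal.closure_eq_preimage_closure_image]
    refine commutantOrbit_induction (p := fun y => y ∈ closure (Subtype.val '' Set.range e))
      isClosed_closure (fun m hm => subset_closure ?_) x.2
    exact ⟨_, ⟨⟨m, hm⟩, rfl⟩, rfl⟩
  have hn : ∀ a, ‖f a‖ ≤ 1 * ‖e a‖ := fun a => by
    rw [one_mul]; exact (h a a.2).le
  have hfe : ∀ (m : H →L[ℂ] H) (hm : m ∈ M.commutant),
      f.extendOfNorm e ⟨m η, apply_mem_commutantOrbit M η hm⟩ = m ζ :=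
    fun m hm => LinearMap.extendOfNorm_eq he ⟨1, hn⟩ ⟨m, hm⟩
  refine ⟨_, comp_projection_mem (f.extendOfNorm e) ?_, fun x => ?_, ?_⟩
  · intro m hm n hn
    rw [hfe n hn]
    exact (hfe (m * n) (mul_mem hm hn)).symm
  · refine (LinearMap.norm_extendOfNorm_apply_le he 1 hn _).trans ?_
    rw [one_mul]
    exact (commutantOrbit M η).norm_orthogonalProjectionOnto_apply_le x
  · have h1 := hfe 1 (one_mem _)
    rw [ContinuousLinearMap.comp_apply]
    refine Eq.trans (congrArg _ ?_) h1
    exact (commutantOrbit M η).orthogonalProjectionOnto_mem_subspace_eq_self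
      ⟨η, self_mem_commutantOrbit M η⟩

/-- A vector of the closure of `M' ω` that is real-orthogonal to `M_sa ω` and to `i M'_sa ω`
vanishes. -/
theorem eq_zero_of_re_im_orbit {M : VonNeumannAlgebra H} {ω ξ : H} (hξ : ξ ∈ commutantOrbit M ω)
    (hre : ∀ m ∈ M, IsSelfAdjoint m → (inner ℂ ξ (m ω)).re = 0)
    (him : ∀ m ∈ M.commutant, IsSelfAdjoint m → (inner ℂ ξ (m ω)).im = 0) : ξ = 0 := by
  -- By `him`, the algebra `M'` cannot distinguish `ξ + i ω` from `ξ - i ω`, so some contraction `v`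
  -- in `M` maps the first to the second. By `hre` it also maps the second to the first. Then `v`
  -- fixes `ξ` and negates `ω`; commuting with `M'`, it is `-1` on the closure of `M' ω`, which
  -- contains `ξ`.
  set η := ξ + Complex.I • ω with hη
  set ζ := ξ - Complex.I • ω with hζ
  have hnorm : ∀ m ∈ M.commutant, ‖m ζ‖ = ‖m η‖ := by
    intro m hm
    have h1 : (inner ℂ (m ξ) (m ω)).im = 0 := by
      have := him (star m * m) (mul_mem (star_mem hm) hm) (IsSelfAdjoint.star_mul_self m)
      rwa [mul_apply_eq_comp, ContinuousLinearMap.star_eq_adjoint,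
        ContinuousLinearMap.adjoint_inner_right] at this
    have h2 : RCLike.re (inner ℂ (m ξ) (Complex.I • m ω)) = 0 := by
      simp [h1]
    have h3 := norm_add_sq (𝕜 := ℂ) (m ξ) (Complex.I • m ω)
    have h4 := norm_sub_sq (𝕜 := ℂ) (m ξ) (Complex.I • m ω)
    rw [h2] at h3 h4
    rw [hη, hζ, map_add, map_sub, map_smul]
    exact (sq_eq_sq₀ (norm_nonneg _) (norm_nonneg _)).mp (by rw [h3, h4]; ring)
  obtain ⟨v, hvM, hv, hvη⟩ := exists_contraction_mem hnorm
  -- For self-adjoint `b` the sum is `2 Re ⟪ξ, b ω⟫`. It is conjugate-linear in the operator, so it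
  -- vanishes on all of `M`.
  have hanti : inner ℂ (v ξ) ω + inner ℂ (v ω) ξ = 0 := by
    have hsa : ∀ b ∈ M, IsSelfAdjoint b → inner ℂ (b ξ) ω + inner ℂ (b ω) ξ = 0 := by
      intro b hb hbs
      rw [inner_apply_of_isSelfAdjoint hbs, ← inner_conj_symm (b ω), Complex.add_conj,
        hre b hb hbs]
      simp
    obtain ⟨b, hb, c, hc, hbs, hcs, rfl⟩ := exists_selfAdjoint_add_smul_selfAdjoint M hvM
    simp only [add_apply, smul_apply, inner_add_left, inner_smul_left]
    linear_combination hsa b hb hbs + starRingEnd ℂ Complex.I * hsa c hc hcs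
  have hsym : inner ℂ (v ζ) η = inner ℂ (v η) ζ := by
    simp only [hη, hζ, map_add, map_sub, map_smul, inner_add_left, inner_sub_left, inner_add_right,
      inner_sub_right, inner_smul_left, inner_smul_right, Complex.conj_I]
    linear_combination 2 * Complex.I * hanti
  have hηζ : ‖ζ‖ = ‖η‖ := hnorm 1 (one_mem _)
  -- Equality case of Cauchy–Schwarz: `⟪v ζ, η⟫ = ‖ζ‖²` with `‖v ζ‖ ≤ ‖ζ‖ = ‖η‖`.
  have hvζ : v ζ = η := by
    have h1 := norm_sub_sq (𝕜 := ℂ) (v ζ) η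
    rw [hsym, hvη, inner_self_eq_norm_sq] at h1
    have h2 := pow_le_pow_left₀ (norm_nonneg _) (hv ζ) 2
    have h3 : ‖v ζ - η‖ ^ 2 ≤ 0 := by rw [h1, ← hηζ]; linarith
    have h4 : ‖v ζ - η‖ = 0 := by nlinarith [norm_nonneg (v ζ - η)]
    exact sub_eq_zero.mp (norm_eq_zero.mp h4)
  have hξ' : v ξ = ξ := by
    have e : ξ = (2⁻¹ : ℂ) • (η + ζ) := by rw [hη, hζ]; module
    rw [e, map_smul, map_add, hvη, hvζ, add_comm]
  have hω : v ω = -ω := by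
    have e : ω = (-Complex.I * 2⁻¹ : ℂ) • (η - ζ) := by
      rw [hη, hζ]
      match_scalars
      · linear_combination Complex.I_mul_I
      · ring
    rw [e, map_smul, map_sub, hvη, hvζ]
    module
  have hneg : v ξ = -ξ := by
    refine commutantOrbit_induction (p := fun x => v x = -x)
      (isClosed_eq (by fun_prop) (by fun_prop)) (fun m hm => ?_) hξ
    have := VonNeumannAlgebra.mem_commutant_iff.mp hm v hvM
    rw [← mul_apply_eq_comp, this, mul_apply_eq_comp, hω, map_neg]
  rw [hξ'] at hneg
  have h2 : (2 : ℂ) • ξ = 0 := by rw [two_smul]; exact add_eq_zero_iff_eq_neg.mpr hneg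
  exact (smul_eq_zero.mp h2).resolve_left two_ne_zero

/-- The closed real subspace generated by `e M_sa ω`, where `e` is the projection onto the closure
of `M' ω`. -/
noncomputable def realOrbit (M : VonNeumannAlgebra H) (ω : H) : Submodule ℝ H :=
  (Submodule.span ℝ {x | ∃ m ∈ M, IsSelfAdjoint m ∧
    x = (commutantOrbit M ω).starProjection (m ω)}).topologicalClosure

instance (M : VonNeumannAlgebra H) (ω : H) : CompleteSpace (realOrbit M ω) :=
  (Submodule.isClosed_topologicalClosure _).completeSpace_coe

theorem realOrbit_inner_im {M : VonNeumannAlgebra H} {ω : H} {m : H →L[ℂ] H}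
    (hm : m ∈ M.commutant) (hs : IsSelfAdjoint m) {x : H} (hx : x ∈ realOrbit M ω) :
    (inner ℂ x (m ω)).im = 0 := by
  refine im_inner_eq_zero_of_closure_span ?_ hx
  rintro _ ⟨n, hn, hns, rfl⟩
  rw [Submodule.inner_starProjection_left_eq_right, Submodule.starProjection_eq_self_iff.mpr
    (apply_mem_commutantOrbit M ω hm)]
  exact im_inner_apply_apply hns hs (VonNeumannAlgebra.mem_commutant_iff.mp hm n hn) ω

theorem realOrbit_le {M : VonNeumannAlgebra H} {ω x : H} (hx : x ∈ realOrbit M ω) :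
    x ∈ commutantOrbit M ω := by
  refine closure_span_induction (p := fun x => x ∈ commutantOrbit M ω)
    (Submodule.isClosed_topologicalClosure _) (zero_mem _) ?_ (fun _ _ => add_mem) ?_ hx
  · rintro _ ⟨n, -, -, rfl⟩
    exact Submodule.starProjection_apply_mem _ _
  · intro r x hx
    rw [← Complex.coe_smul]
    exact Submodule.smul_mem _ _ hx

/-- Both `x` and `i x` have real inner products with `M'_sa ω`, so `x` is orthogonal to `M' ω`,
whose closure contains it. -/
theorem realOrbit_inter_smul {M : VonNeumannAlgebra H} {ω : H} :
    ∀ x ∈ realOrbit M ω, Complex.I • x ∈ realOrbit M ω → x = 0 := by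
  intro x hx hIx
  have h0 : ∀ m ∈ M.commutant, IsSelfAdjoint m → inner ℂ x (m ω) = 0 := by
    intro m hm hs
    have h1 := realOrbit_inner_im hm hs hx
    have h2 := realOrbit_inner_im hm hs hIx
    rw [inner_smul_left] at h2
    simp at h2
    exact Complex.ext h2 h1
  have h1 : inner ℂ x x = (0 : ℂ) := by
    refine commutantOrbit_induction (p := fun y => inner ℂ x y = (0 : ℂ))
      (isClosed_eq (by fun_prop) continuous_const) (fun m hm => ?_) (realOrbit_le hx)
    obtain ⟨b, hb, c, hc, hbs, hcs, rfl⟩ := exists_selfAdjoint_add_smul_selfAdjoint _ hm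
    simp [h0 b hb hbs, h0 c hc hcs]
  exact inner_self_eq_zero.mp h1

/-- The real orthogonal complement of `e M_sa ω` in the closure of `M' ω` is generated by
`i M'_sa ω`. -/
theorem projection_mem_of_mem_realOrbit_orthogonal {M : VonNeumannAlgebra H} {ω x : H}
    (hx : x ∈ (realOrbit M ω).orthogonal) :
    (commutantOrbit M ω).starProjection x ∈
      (Submodule.span ℝ {y | ∃ m ∈ M.commutant, IsSelfAdjoint m ∧
        y = Complex.I • m ω}).topologicalClosure := by
  set E := commutantOrbit M ω
  set s := {y | ∃ m ∈ M.commutant, IsSelfAdjoint m ∧ y = Complex.I • m ω}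
  let L := (Submodule.span ℝ s).topologicalClosure
  have hc : CompleteSpace L := (Submodule.isClosed_topologicalClosure _).completeSpace_coe
  have hLE : ∀ y ∈ L, y ∈ E := fun y hy => by
    refine closure_span_induction (p := fun x => x ∈ E)
      (Submodule.isClosed_topologicalClosure _) (zero_mem _) ?_ (fun _ _ => add_mem) ?_ hy
    · rintro _ ⟨n, hn, -, rfl⟩
      exact E.smul_mem _ (apply_mem_commutantOrbit M ω hn)
    · intro r x hx
      rw [← Complex.coe_smul]
      exact E.smul_mem _ hx
  set d := L.starProjection (E.starProjection x) with hd
  have hdL : d ∈ L := L.starProjection_apply_mem _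
  -- The residual is real-orthogonal to `M_sa ω`: its first term because `x` is real-orthogonal to
  -- `realOrbit M ω`, and `d` because `i M'_sa ω` is real-orthogonal to `M_sa ω`. Orthogonality to
  -- `i M'_sa ω` is the defining property of the projection `d`.
  have hzero : E.starProjection x - d = 0 := by
    refine eq_zero_of_re_im_orbit (M := M) (ω := ω)
      (sub_mem (E.starProjection_apply_mem x) (hLE d hdL)) (fun m hm hs => ?_) (fun m hm hs => ?_)
    · have h1 : (inner ℂ (E.starProjection x) (m ω)).re = 0 := by
        rw [E.inner_starProjection_left_eq_right, ← inner_conj_symm, Complex.conj_re]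
        exact hx _ (mem_closure_span ⟨m, hm, hs, rfl⟩)
      have h2 : (inner ℂ d (Complex.I • m ω)).im = 0 := by
        refine im_inner_eq_zero_of_closure_span ?_ hdL
        rintro _ ⟨n, hn, hns, rfl⟩
        have := im_inner_apply_apply hns hs (VonNeumannAlgebra.mem_commutant_iff.mp hn m hm).symm ω
        simp [this]
      rw [inner_smul_right] at h2
      simp at h2
      rw [inner_sub_left, Complex.sub_re, h1, h2, sub_zero]
    · have : (inner ℂ (E.starProjection x - d) (Complex.I • m ω)).re = 0 :=
        L.starProjection_inner_eq_zero _ _ (mem_closure_span ⟨m, hm, hs, rfl⟩)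
      rw [inner_smul_right, Complex.I_mul_re] at this
      exact neg_eq_zero.mp this
  rw [sub_eq_zero.mp hzero]
  exact hdL

end Commutation

end FermiProduct

namespace FermiProduct

/-! ### Tomita's commutation theorem for tensor products. -/

section Tomita

variable {H : Type*} [NormedAddCommGroup H] [InnerProductSpace ℂ H] [CompleteSpace H]
  {K : Type*} [NormedAddCommGroup K] [InnerProductSpace ℂ K] [CompleteSpace K]

attribute [local instance] InnerProductSpace.complexToReal

theorem im_inner_tmul_closure_span {s : Set H} {t : Set K} (ζ : HilbertTensor H K)
    (h : ∀ x ∈ s, ∀ y ∈ t, (inner ℂ ζ (tmul x y)).im = 0) {x : H} {y : K}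
    (hx : x ∈ (Submodule.span ℝ s).topologicalClosure)
    (hy : y ∈ (Submodule.span ℝ t).topologicalClosure) : (inner ℂ ζ (tmul x y)).im = 0 := by
  have hc1 : ∀ y : K, Continuous fun x : H => tmul x y := fun y => by
    simp only [← tmulL_apply]; fun_prop
  have hc2 : ∀ x : H, Continuous fun y : K => tmul x y := fun x => by
    simp only [← tmulL_apply]; fun_prop
  have h1 : ∀ x ∈ s, (inner ℂ ζ (tmul x y)).im = 0 := fun x hx' => by
    refine closure_span_induction (p := fun y => (inner ℂ ζ (tmul x y)).im = 0)
      (isClosed_eq (Complex.continuous_im.comp (continuous_const.inner (hc2 x))) continuous_const)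
      (by rw [← tmulL_apply]; simp) (h x hx') ?_ ?_ hy
    · intro a b ha hb
      rw [← tmulL_apply, map_add, inner_add_right, Complex.add_im, tmulL_apply, tmulL_apply, ha,
        hb, add_zero]
    · intro r a ha
      rw [← Complex.coe_smul, ← tmulL_apply, map_smul, inner_smul_right, tmulL_apply]
      simp [ha]
  refine closure_span_induction (p := fun x => (inner ℂ ζ (tmul x y)).im = 0)
    (isClosed_eq (Complex.continuous_im.comp (continuous_const.inner (hc1 y))) continuous_const)
    (by rw [← tmulL_apply]; simp) h1 ?_ ?_ hx
  · intro a b ha hb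
    rw [← tmulL_apply, map_add, add_apply, inner_add_right, Complex.add_im, tmulL_apply,
      tmulL_apply, ha, hb, add_zero]
  · intro r a ha
    rw [← Complex.coe_smul, ← tmulL_apply, map_smul, smul_apply, inner_smul_right, tmulL_apply]
    simp [ha]

theorem im_inner_I_smul_left {G : Type*} [NormedAddCommGroup G] [InnerProductSpace ℂ G] (ζ ξ : G) :
    (inner ℂ (Complex.I • ζ) ξ).im = -(inner ℂ ζ ξ).re := by
  rw [inner_smul_left]; simp

/-- With `ω = a ⊗ b`, the compression `e` commutes with `X` and fixes `ω`, so `Y ω` may be replaced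
by `e Y ω`. The latter is its own projection `d` onto the closed real span of the vectors `e (m a ⊗
n b)`, with which `X ω` has real inner products because `X` commutes with `m ⊗ n`. -/
theorem im_inner_apply_tmul_of_commute_tensor {M : VonNeumannAlgebra H}
    {N : VonNeumannAlgebra K} {X Y : HilbertTensor H K →L[ℂ] HilbertTensor H K}
    (hXs : IsSelfAdjoint X) (hYs : IsSelfAdjoint Y)
    (hX : ∀ S ∈ M, ∀ T ∈ N, tensorOp S T * X = X * tensorOp S T)
    (hY : ∀ S ∈ M.commutant, ∀ T ∈ N.commutant, tensorOp S T * Y = Y * tensorOp S T)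
    (a : H) (b : K) : (inner ℂ (Y (tmul a b)) (X (tmul a b))).im = 0 := by
  set e₁ := (commutantOrbit M a).starProjection
  set e₂ := (commutantOrbit N b).starProjection
  set e := tensorOp e₁ e₂
  have he₁ : e₁ ∈ M := starProjection_commutantOrbit_mem M a
  have he₂ : e₂ ∈ N := starProjection_commutantOrbit_mem N b
  have hs₁ : IsSelfAdjoint e₁ := isSelfAdjoint_starProjection _
  have hs₂ : IsSelfAdjoint e₂ := isSelfAdjoint_starProjection _
  have hes : IsSelfAdjoint e := tensorOp_isSelfAdjoint hs₁ hs₂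
  have hfix₁ : ∀ x ∈ commutantOrbit M a, e₁ x = x := fun x hx =>
    Submodule.starProjection_eq_self_iff.mpr hx
  have hfix₂ : ∀ x ∈ commutantOrbit N b, e₂ x = x := fun x hx =>
    Submodule.starProjection_eq_self_iff.mpr hx
  have heω : e (tmul a b) = tmul a b := by
    rw [tensorOp_tmul, hfix₁ _ (self_mem_commutantOrbit M a),
      hfix₂ _ (self_mem_commutantOrbit N b)]
  have heX : ∀ z, inner ℂ (e z) (X (tmul a b)) = inner ℂ z (X (tmul a b)) := fun z => by
    rw [inner_apply_of_isSelfAdjoint hes, ← mul_apply_eq_comp, hX _ he₁ _ he₂, mul_apply_eq_comp,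
      heω]
  let D : Set (HilbertTensor H K) := {z | ∃ m ∈ M, IsSelfAdjoint m ∧ ∃ n ∈ N, IsSelfAdjoint n ∧
    z = e (tmul (m a) (n b))}
  obtain ⟨d, hd1, hd2⟩ := exists_real_projection D (e (Y (tmul a b)))
  have hD : ∀ l₁ ∈ M.commutant, IsSelfAdjoint l₁ → ∀ l₂ ∈ N.commutant, IsSelfAdjoint l₂ →
      ∀ z ∈ D, (inner ℂ z (tmul (l₁ a) (l₂ b))).im = 0 := by
    rintro l₁ hl₁ hls₁ l₂ hl₂ hls₂ _ ⟨m, hm, hms, n, hn, hns, rfl⟩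
    rw [inner_apply_of_isSelfAdjoint hes, tensorOp_tmul,
      hfix₁ _ (apply_mem_commutantOrbit M a hl₁), hfix₂ _ (apply_mem_commutantOrbit N b hl₂),
      inner_tmul_tmul, Complex.mul_im,
      im_inner_apply_apply hms hls₁ (VonNeumannAlgebra.mem_commutant_iff.mp hl₁ m hm),
      im_inner_apply_apply hns hls₂ (VonNeumannAlgebra.mem_commutant_iff.mp hl₂ n hn)]
    simp
  have hYl : ∀ l₁ ∈ M.commutant, IsSelfAdjoint l₁ → ∀ l₂ ∈ N.commutant, IsSelfAdjoint l₂ →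
      (inner ℂ (e (Y (tmul a b))) (tmul (l₁ a) (l₂ b))).im = 0 := by
    intro l₁ hl₁ hls₁ l₂ hl₂ hls₂
    rw [inner_apply_of_isSelfAdjoint hes, tensorOp_tmul,
      hfix₁ _ (apply_mem_commutantOrbit M a hl₁), hfix₂ _ (apply_mem_commutantOrbit N b hl₂),
      ← tensorOp_tmul]
    exact im_inner_apply_apply hYs (tensorOp_isSelfAdjoint hls₁ hls₂) (hY l₁ hl₁ l₂ hl₂).symm _
  have hzero : e (Y (tmul a b)) - d = 0 := by
    refine eq_zero_of_re_im_tmul (realOrbit M a) (realOrbit N b) realOrbit_inter_smul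
      realOrbit_inter_smul (fun x hx y hy => ?_) (fun x hx y hy => ?_)
    · have := im_inner_tmul_closure_span (Complex.I • (e (Y (tmul a b)) - d)) ?_ hx hy
      · rwa [im_inner_I_smul_left, neg_eq_zero] at this
      · rintro _ ⟨m, hm, hms, rfl⟩ _ ⟨n, hn, hns, rfl⟩
        rw [im_inner_I_smul_left, neg_eq_zero]
        refine hd1 _ ⟨m, hm, hms, n, hn, hns, ?_⟩
        rw [tensorOp_tmul]
    -- The compressed complements are generated by vectors `i m a` and `i n b` with `m`, `n` in the
    -- commutants. The two factors `i` multiply to `-1`, leaving the real inner products of `hYl`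
    -- and `hD`.
    · have hproj : (inner ℂ (e (Y (tmul a b)) - d) (tmul (e₁ x) (e₂ y))).im = 0 := by
        refine im_inner_tmul_closure_span _ ?_ (projection_mem_of_mem_realOrbit_orthogonal hx)
          (projection_mem_of_mem_realOrbit_orthogonal hy)
        rintro _ ⟨m, hm, hms, rfl⟩ _ ⟨n, hn, hns, rfl⟩
        have h1 : tmul (Complex.I • m a) (Complex.I • n b) = -tmul (m a) (n b) := by
          simp only [← tmulL_apply, map_smul, smul_apply, smul_smul, Complex.I_mul_I, neg_smul,
            one_smul]
        rw [h1, inner_neg_right, inner_sub_left, Complex.neg_im, Complex.sub_im,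
          hYl m hm hms n hn hns, hd2 _ (hD m hm hms n hn hns), sub_zero, neg_zero]
      -- The vector `e Y ω` and the generators of the span containing `d` lie in the range of `e`,
      -- to which this difference is orthogonal.
      have hdiff : (inner ℂ (e (Y (tmul a b)) - d) (tmul x y - tmul (e₁ x) (e₂ y))).im = 0 := by
        have hee : ∀ z, e (e z) = e z := fun z => by
          rw [← mul_apply_eq_comp, tensorOp_mul]
          congr 2 <;> exact Submodule.isIdempotentElem_starProjection _
        have h0 : ∀ z, inner ℂ (e z) (tmul x y - tmul (e₁ x) (e₂ y)) = 0 := fun z => by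
          rw [← tensorOp_tmul, inner_sub_right, ← inner_apply_of_isSelfAdjoint hes, hee, sub_self]
        rw [inner_sub_left, h0, zero_sub, Complex.neg_im, hd2, neg_zero]
        rintro _ ⟨m, hm, hms, n, hn, hns, rfl⟩
        rw [h0, Complex.zero_im]
      rw [inner_sub_right, Complex.sub_im, hproj, sub_zero] at hdiff
      exact hdiff
  rw [← heX, sub_eq_zero.mp hzero]
  refine hd2 _ ?_
  rintro _ ⟨m, hm, hms, n, hn, hns, rfl⟩
  rw [heX, ← tensorOp_tmul]
  exact im_inner_apply_apply (tensorOp_isSelfAdjoint hms hns) hXs (hX m hm n hn) _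

/-- Complex polarization, one tensor factor at a time. -/
theorem eq_zero_of_inner_tmul_self {C : HilbertTensor H K →L[ℂ] HilbertTensor H K}
    (h : ∀ a b, inner ℂ (C (tmul a b)) (tmul a b) = 0) : C = 0 := by
  have h1 : ∀ a a' b, inner ℂ (C (tmul a b)) (tmul a' b) = 0 := fun a a' b => by
    let j := (tmulL H K).flip b
    have hj : (j.adjoint ∘L C ∘L j).toLinearMap = 0 := by
      rw [← inner_map_self_eq_zero]
      exact fun x => by simpa [ContinuousLinearMap.adjoint_inner_left, j, tmulL_apply] using h x b
    have := congrArg (fun T : H →ₗ[ℂ] H => inner ℂ (T a) a') hj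
    simpa [ContinuousLinearMap.adjoint_inner_left, j, tmulL_apply] using this
  refine tensor_op_ext fun a b => ?_
  rw [zero_apply]
  refine eq_zero_of_inner_tmul fun a' b' => ?_
  have hj : ((tmulL H K a').adjoint ∘L C ∘L tmulL H K a).toLinearMap = 0 := by
    rw [← inner_map_self_eq_zero]
    exact fun y => by simpa [ContinuousLinearMap.adjoint_inner_left, tmulL_apply] using h1 a a' y
  have := congrArg (fun T : K →ₗ[ℂ] K => inner ℂ (T b) b') hj
  simpa [ContinuousLinearMap.adjoint_inner_left, tmulL_apply] using this

theorem coe_generated (s : Set (H →L[ℂ] H)) :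
    (generated s : Set (H →L[ℂ] H)) = Set.centralizer (Set.centralizer (s ∪ star s)) := by
  change (StarSubalgebra.centralizer ℂ (Set.centralizer (s ∪ star s)) : Set (H →L[ℂ] H)) = _
  rw [StarSubalgebra.coe_centralizer, Set.star_centralizer, Set.union_star, star_star,
    Set.union_comm (star s) s, Set.union_self]

theorem mem_commutant_generated_iff {s : Set (H →L[ℂ] H)} {X : H →L[ℂ] H} :
    X ∈ (generated s).commutant ↔
      ∀ A ∈ s, A * X = X * A ∧ star A * X = X * star A := by
  rw [← SetLike.mem_coe, VonNeumannAlgebra.coe_commutant, coe_generated,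
    Set.centralizer_centralizer_centralizer, Set.mem_centralizer_iff]
  constructor
  · exact fun h A hA => ⟨h A (Or.inl hA), h _ (Or.inr (by simpa using hA))⟩
  · rintro h A (hA | hA)
    · exact (h A hA).1
    · simpa using (h _ hA).2

/-- The von Neumann algebra tensor product. -/
noncomputable def tensorAlgebra (M : VonNeumannAlgebra H) (N : VonNeumannAlgebra K) :
    VonNeumannAlgebra (HilbertTensor H K) :=
  generated {R | ∃ S ∈ M, ∃ T ∈ N, R = tensorOp S T}

theorem mem_commutant_tensorAlgebra_iff {M : VonNeumannAlgebra H} {N : VonNeumannAlgebra K}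
    {X : HilbertTensor H K →L[ℂ] HilbertTensor H K} :
    X ∈ (tensorAlgebra M N).commutant ↔
      ∀ S ∈ M, ∀ T ∈ N, tensorOp S T * X = X * tensorOp S T := by
  rw [tensorAlgebra, mem_commutant_generated_iff]
  constructor
  · exact fun h S hS T hT => (h _ ⟨S, hS, T, hT, rfl⟩).1
  · rintro h _ ⟨S, hS, T, hT, rfl⟩
    rw [star_tensorOp]
    exact ⟨h S hS T hT, h _ (star_mem hS) _ (star_mem hT)⟩

/-- **Tomita's commutation theorem**: the commutants of `M ⊗ N` and of `M' ⊗ N'` commute. -/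
theorem commute_of_mem_commutant_tensorAlgebra {M : VonNeumannAlgebra H} {N : VonNeumannAlgebra K}
    {X Y : HilbertTensor H K →L[ℂ] HilbertTensor H K}
    (hX : X ∈ (tensorAlgebra M N).commutant)
    (hY : Y ∈ (tensorAlgebra M.commutant N.commutant).commutant) : Commute X Y := by
  have hsa : ∀ X ∈ (tensorAlgebra M N).commutant,
      ∀ Y ∈ (tensorAlgebra M.commutant N.commutant).commutant,
      IsSelfAdjoint X → IsSelfAdjoint Y → Commute X Y := by
    intro X hX Y hY hXs hYs
    -- For `ω = a ⊗ b`, `⟪(X Y - Y X) ω, ω⟫ = 2 i Im ⟪Y ω, X ω⟫`.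
    refine sub_eq_zero.mp (eq_zero_of_inner_tmul_self fun a b => ?_)
    have := im_inner_apply_tmul_of_commute_tensor hXs hYs (mem_commutant_tensorAlgebra_iff.mp hX)
      (mem_commutant_tensorAlgebra_iff.mp hY) a b
    rw [sub_apply, mul_apply_eq_comp, mul_apply_eq_comp, inner_sub_left,
      inner_apply_of_isSelfAdjoint hXs, inner_apply_of_isSelfAdjoint hYs (X _),
      ← inner_conj_symm (X _), Complex.sub_conj, this]
    simp
  obtain ⟨A, hA, B, hB, hAs, hBs, rfl⟩ := exists_selfAdjoint_add_smul_selfAdjoint _ hX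
  obtain ⟨C, hC, D, hD, hCs, hDs, rfl⟩ := exists_selfAdjoint_add_smul_selfAdjoint _ hY
  exact (((hsa A hA C hC hAs hCs).add_right ((hsa A hA D hD hAs hDs).smul_right _))).add_left
    (((hsa B hB C hC hBs hCs).add_right ((hsa B hB D hD hBs hDs).smul_right _)).smul_left _)

end Tomita

end FermiProduct

namespace FermiProduct

/-! ### Parity and signs in Fermi products. -/

section Graded

variable {H : Type*} [NormedAddCommGroup H] [InnerProductSpace ℂ H] [CompleteSpace H]
  {K : Type*} [NormedAddCommGroup K] [InnerProductSpace ℂ K] [CompleteSpace K]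

theorem Grading.op_mul_op_mul (U : Grading H) (X : H →L[ℂ] H) : U.op * (U.op * X) = X := by
  rw [← mul_assoc, U.op_mul_op, one_mul]

theorem Grading.op_mul_evenPart (U : Grading H) (T : H →L[ℂ] H) :
    U.op * U.evenPart T = U.evenPart T * U.op := by
  simp only [Grading.evenPart, mul_smul_comm, smul_mul_assoc, mul_add, add_mul, mul_assoc,
    U.op_mul_op_mul, U.op_mul_op, mul_one]
  rw [add_comm]

theorem Grading.op_mul_oddPart (U : Grading H) (T : H →L[ℂ] H) :
    U.op * U.oddPart T = -(U.oddPart T * U.op) := by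
  simp only [Grading.oddPart, mul_smul_comm, smul_mul_assoc, mul_sub, sub_mul, mul_assoc,
    U.op_mul_op_mul, U.op_mul_op, mul_one]
  module

theorem Grading.evenPart_of_comm (U : Grading H) {T : H →L[ℂ] H} (h : U.op * T = T * U.op) :
    U.evenPart T = T :=
  (U.parts_of_even (by rw [h, mul_assoc, U.op_mul_op, mul_one])).1

theorem Grading.oddPart_of_comm (U : Grading H) {T : H →L[ℂ] H} (h : U.op * T = T * U.op) :
    U.oddPart T = 0 :=
  (U.parts_of_even (by rw [h, mul_assoc, U.op_mul_op, mul_one])).2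

theorem Grading.evenPart_of_anticomm (U : Grading H) {T : H →L[ℂ] H}
    (h : U.op * T = -(T * U.op)) : U.evenPart T = 0 :=
  (U.parts_of_odd (by rw [h, neg_mul, mul_assoc, U.op_mul_op, mul_one])).1

theorem Grading.oddPart_of_anticomm (U : Grading H) {T : H →L[ℂ] H}
    (h : U.op * T = -(T * U.op)) : U.oddPart T = T :=
  (U.parts_of_odd (by rw [h, neg_mul, mul_assoc, U.op_mul_op, mul_one])).2

theorem Grading.Preserves.conj_mem {U : Grading H} {M : VonNeumannAlgebra H} (hM : U.Preserves M)
    {S : H →L[ℂ] H} (hS : S ∈ M) : U.op * S * U.op ∈ M :=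
  hM.subset ⟨S, hS, rfl⟩

theorem Grading.Preserves.commutant {U : Grading H} {M : VonNeumannAlgebra H}
    (hM : U.Preserves M) : U.Preserves M.commutant := by
  have h : ∀ S ∈ M.commutant, U.op * S * U.op ∈ M.commutant := by
    intro S hS
    rw [VonNeumannAlgebra.mem_commutant_iff] at hS ⊢
    intro T hT
    have h1 := congrArg (fun X => U.op * X * U.op) (hS _ (hM.conj_mem hT))
    simpa only [mul_assoc, U.op_mul_op_mul, U.op_mul_op, mul_one] using h1
  refine Set.Subset.antisymm ?_ fun S hS => ⟨U.op * S * U.op, h S hS, ?_⟩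
  · rintro _ ⟨S, hS, rfl⟩
    exact h S hS
  · simp only [mul_assoc, U.op_mul_op_mul, U.op_mul_op, mul_one]

theorem Grading.Preserves.evenPart_mem {U : Grading H} {M : VonNeumannAlgebra H}
    (hM : U.Preserves M) {S : H →L[ℂ] H} (hS : S ∈ M) : U.evenPart S ∈ M :=
  smul_mem_vonNeumannAlgebra M _ (add_mem hS (hM.conj_mem hS))

theorem Grading.Preserves.oddPart_mem {U : Grading H} {M : VonNeumannAlgebra H}
    (hM : U.Preserves M) {S : H →L[ℂ] H} (hS : S ∈ M) : U.oddPart S ∈ M :=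
  smul_mem_vonNeumannAlgebra M _ (sub_mem hS (hM.conj_mem hS))

theorem tensorOp_sub_left (S S' : H →L[ℂ] H) (T : K →L[ℂ] K) :
    tensorOp (S - S') T = tensorOp S T - tensorOp S' T := by
  rw [eq_sub_iff_add_eq, ← tensorOp_add_left, sub_add_cancel]

theorem tensorOp_sub_right (S : H →L[ℂ] H) (T T' : K →L[ℂ] K) :
    tensorOp S (T - T') = tensorOp S T - tensorOp S T' := by
  rw [eq_sub_iff_add_eq, ← tensorOp_add_right, sub_add_cancel]

theorem tensorOp_neg_left (S : H →L[ℂ] H) (T : K →L[ℂ] K) :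
    tensorOp (-S) T = -tensorOp S T := by
  rw [← neg_one_smul ℂ, tensorOp_smul_left, neg_one_smul]

theorem tensorOp_neg_right (S : H →L[ℂ] H) (T : K →L[ℂ] K) :
    tensorOp S (-T) = -tensorOp S T := by
  rw [← neg_one_smul ℂ, tensorOp_smul_right, neg_one_smul]

theorem tensorOp_zero_right (S : H →L[ℂ] H) : tensorOp S (0 : K →L[ℂ] K) = 0 := by
  rw [← zero_smul ℂ (0 : K →L[ℂ] K), tensorOp_smul_right, zero_smul]

theorem tensorOp_zero_left (T : K →L[ℂ] K) : tensorOp (0 : H →L[ℂ] H) T = 0 := by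
  rw [← zero_smul ℂ (0 : H →L[ℂ] H), tensorOp_smul_left, zero_smul]

/-- The operators `S₊ ⊗ T + S₋ ⊗ V T`, which the twist of the tensor product maps to the Fermi
products of twisted operators. -/
noncomputable def untwistedFermiOp (U : Grading H) (V : Grading K) (S : H →L[ℂ] H)
    (T : K →L[ℂ] K) : HilbertTensor H K →L[ℂ] HilbertTensor H K :=
  tensorOp (U.evenPart S) T + tensorOp (U.oddPart S) (V.op * T)

theorem twist_untwistedFermiOp (U : Grading H) (V : Grading K) (S : H →L[ℂ] H)
    (T : K →L[ℂ] K) :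
    (U.tensor V).twist (untwistedFermiOp U V S T) = fermiOp U V (U.twist S) (V.twist T) := by
  have hop : (U.tensor V).op = tensorOp U.op V.op := rfl
  simp only [Grading.twist, Grading.evenPart, Grading.oddPart, untwistedFermiOp, fermiOp, hop,
    tensorOp_add_left, tensorOp_add_right, tensorOp_sub_left, tensorOp_sub_right,
    tensorOp_smul_left, tensorOp_smul_right, mul_add, add_mul, mul_sub, sub_mul, smul_mul_assoc,
    mul_smul_comm, tensorOp_mul, mul_assoc, Grading.op_mul_op_mul, Grading.op_mul_op, mul_one,
    smul_add, smul_sub]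
  match_scalars <;> ring_nf <;> simp only [Complex.I_sq] <;> ring

theorem star_mul_op_eq (U : Grading H) (S : H →L[ℂ] H) :
    star (S * U.op) = U.op * star S * U.op * U.op := by
  rw [star_mul, U.isSelfAdjoint.star_eq, mul_assoc _ U.op, U.op_mul_op, mul_one]

/-- Invariance of `N` allows `T` to be taken homogeneous. Invariance of `M` handles the adjoints,
since `(S U)* = (U S* U) U` has the form of a generator again. -/
theorem mem_commutant_fermiProduct_iff {U : Grading H} {V : Grading K} {M : VonNeumannAlgebra H}
    {N : VonNeumannAlgebra K} (hM : U.Preserves M) (hN : V.Preserves N)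
    {X : HilbertTensor H K →L[ℂ] HilbertTensor H K} :
    X ∈ (fermiProduct U V M N).commutant ↔
      (∀ S ∈ M, ∀ T ∈ N, V.op * T = T * V.op → tensorOp S T * X = X * tensorOp S T) ∧
      (∀ S ∈ M, ∀ T ∈ N, V.op * T = -(T * V.op) →
        tensorOp (S * U.op) T * X = X * tensorOp (S * U.op) T) := by
  rw [fermiProduct, mem_commutant_generated_iff]
  constructor
  · refine fun h => ⟨fun S hS T hT hVT => ?_, fun S hS T hT hVT => ?_⟩
    · have := (h _ ⟨S, hS, T, hT, rfl⟩).1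
      rwa [fermiOp, V.evenPart_of_comm hVT, V.oddPart_of_comm hVT, tensorOp_zero_right,
        add_zero] at this
    · have := (h _ ⟨S, hS, T, hT, rfl⟩).1
      rwa [fermiOp, V.evenPart_of_anticomm hVT, V.oddPart_of_anticomm hVT, tensorOp_zero_right,
        zero_add] at this
  · rintro ⟨h1, h2⟩ _ ⟨S, hS, T, hT, rfl⟩
    constructor
    · rw [fermiOp, add_mul, mul_add, h1 S hS _ (hN.evenPart_mem hT) (V.op_mul_evenPart T),
        h2 S hS _ (hN.oddPart_mem hT) (V.op_mul_oddPart T)]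
    · rw [fermiOp, star_add, star_tensorOp, star_tensorOp, star_mul_op_eq, add_mul, mul_add,
        h1 _ (star_mem hS) _ (star_mem (hN.evenPart_mem hT)),
        h2 _ (hM.conj_mem (star_mem hS)) _ (star_mem (hN.oddPart_mem hT))]
      · have := congrArg star (V.op_mul_oddPart T)
        simp only [star_mul, star_neg, V.isSelfAdjoint.star_eq] at this
        rw [this, neg_neg]
      · have := congrArg star (V.op_mul_evenPart T)
        simp only [star_mul, V.isSelfAdjoint.star_eq] at this
        exact this.symm

/-- Against `A U ⊗ B` with `B` odd, the sign from moving `U` past `S₋` cancels the sign from moving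
`B` past `V`; for even `B` no sign occurs. -/
theorem untwistedFermiOp_mem_commutant {U : Grading H} {V : Grading K} {M : VonNeumannAlgebra H}
    {N : VonNeumannAlgebra K} (hM : U.Preserves M) (hN : V.Preserves N) {S : H →L[ℂ] H}
    {T : K →L[ℂ] K} (hS : S ∈ M.commutant) (hT : T ∈ N.commutant) :
    untwistedFermiOp U V S T ∈ (fermiProduct U V M N).commutant := by
  have hT' := VonNeumannAlgebra.mem_commutant_iff.mp hT
  have he := VonNeumannAlgebra.mem_commutant_iff.mp (hM.commutant.evenPart_mem hS)
  have ho := VonNeumannAlgebra.mem_commutant_iff.mp (hM.commutant.oddPart_mem hS)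
  rw [mem_commutant_fermiProduct_iff hM hN]
  constructor
  · intro A hA B hB hVB
    simp only [untwistedFermiOp, mul_add, add_mul, tensorOp_mul]
    rw [he A hA, ho A hA, hT' B hB, ← mul_assoc B, ← hVB, mul_assoc, hT' B hB, mul_assoc]
  · intro A hA B hB hVB
    have hBV : B * V.op = -(V.op * B) := by rw [hVB, neg_neg]
    simp only [untwistedFermiOp, mul_add, add_mul, tensorOp_mul]
    rw [mul_assoc A, mul_assoc A, U.op_mul_evenPart, U.op_mul_oddPart, ← mul_assoc A, he A hA,
      mul_neg, ← mul_assoc A, ho A hA, hT' B hB, ← mul_assoc B, hBV, neg_mul, mul_assoc V.op,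
      hT' B hB, tensorOp_neg_left, tensorOp_neg_right, neg_neg]
    simp only [mul_assoc]

/-- Here `w₁`, `w₂` stand for `U ⊗ 1`, `1 ⊗ V`. Signs occur only in `B w₂ w₁ F`, where `B` passes
`w₁` and `w₂` passes `F`, and they cancel. -/
theorem commute_of_graded_decomposition {R : Type*} [Ring R] {A B C F w₁ w₂ : R}
    (hw : w₁ * w₂ = w₂ * w₁) (hA : w₁ * A = A * w₁) (hB : w₁ * B = -(B * w₁))
    (hC : w₂ * C = C * w₂) (hF : w₂ * F = -(F * w₂)) (hAC : A * C = C * A) (hAF : A * F = F * A)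
    (hBC : B * C = C * B) (hBF : B * F = F * B) :
    (A + B * w₂) * (C + w₁ * F) = (C + w₁ * F) * (A + B * w₂) := by
  have h1 : A * (w₁ * F) = w₁ * F * A := by
    rw [← mul_assoc, ← hA, mul_assoc, hAF, mul_assoc]
  have h2 : B * w₂ * C = C * (B * w₂) := by
    rw [mul_assoc, hC, ← mul_assoc, hBC, mul_assoc]
  have h3 : B * w₂ * (w₁ * F) = w₁ * F * (B * w₂) := by
    calc B * w₂ * (w₁ * F) = B * (w₂ * w₁) * F := by simp only [mul_assoc]
      _ = B * w₁ * (w₂ * F) := by rw [← hw]; simp only [mul_assoc]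
      _ = -(B * w₁) * (F * w₂) := by rw [hF]; simp
      _ = w₁ * (B * F) * w₂ := by rw [← hB]; simp only [mul_assoc]
      _ = w₁ * F * (B * w₂) := by rw [hBF]; simp only [mul_assoc]
  rw [add_mul, mul_add, mul_add, add_mul, mul_add, mul_add, hAC, h1, h2, h3]
  abel

end Graded

end FermiProduct

namespace FermiProduct

/-! ### Reduction of the graded statement to Tomita's theorem. -/

section Duality

variable {H : Type*} [NormedAddCommGroup H] [InnerProductSpace ℂ H] [CompleteSpace H]
  {K : Type*} [NormedAddCommGroup K] [InnerProductSpace ℂ K] [CompleteSpace K]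

/-- The grading operator of the first factor, as a grading of the tensor product. -/
noncomputable def Grading.tensorLeft (U : Grading H) (K : Type*) [NormedAddCommGroup K]
    [InnerProductSpace ℂ K] [CompleteSpace K] : Grading (HilbertTensor H K) :=
  U.tensor ⟨1, IsSelfAdjoint.one _, one_mem _⟩

/-- The grading operator of the second factor, as a grading of the tensor product. -/
noncomputable def Grading.tensorRight (V : Grading K) (H : Type*) [NormedAddCommGroup H]
    [InnerProductSpace ℂ H] [CompleteSpace H] : Grading (HilbertTensor H K) :=
  Grading.tensor ⟨1, IsSelfAdjoint.one _, one_mem _⟩ V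

theorem Grading.tensorLeft_op (U : Grading H) : (U.tensorLeft K).op = tensorOp U.op 1 := rfl

theorem Grading.tensorRight_op (V : Grading K) : (V.tensorRight H).op = tensorOp 1 V.op := rfl

/-- If `X` commutes with `A` and with `W A W`, then so do the even and odd parts of `X`. -/
theorem Grading.commute_parts (W : Grading H) {A X : H →L[ℂ] H} (h : A * X = X * A)
    (h' : W.op * A * W.op * X = X * (W.op * A * W.op)) :
    A * W.evenPart X = W.evenPart X * A ∧ A * W.oddPart X = W.oddPart X * A := by
  have h1 : A * (W.op * X * W.op) = W.op * X * W.op * A := by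
    have := congrArg (fun Z => W.op * Z * W.op) h'
    simpa only [mul_assoc, W.op_mul_op_mul, W.op_mul_op, mul_one] using this
  constructor
  · rw [Grading.evenPart, mul_smul_comm, smul_mul_assoc, mul_add, add_mul, h, h1]
  · rw [Grading.oddPart, mul_smul_comm, smul_mul_assoc, mul_sub, sub_mul, h, h1]

theorem tensorOp_eq_add_parts (V : Grading K) (S : H →L[ℂ] H) (T : K →L[ℂ] K) :
    tensorOp S T = tensorOp S (V.evenPart T) + tensorOp S (V.oddPart T) := by
  rw [← tensorOp_add_right, V.evenPart_add_oddPart]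

theorem tensorOp_eq_parts_add (U : Grading H) (S : H →L[ℂ] H) (T : K →L[ℂ] K) :
    tensorOp S T = tensorOp (U.evenPart S) T + tensorOp (U.oddPart S) T := by
  rw [← tensorOp_add_left, U.evenPart_add_oddPart]

/-- Conjugation by `U ⊗ 1` preserves the generators, so both parts of `X` commute with them. For odd
`T`, `S ⊗ T = (S U ⊗ T)(U ⊗ 1)` therefore commutes with the even part and anticommutes with the odd
part. The factor `1 ⊗ V`, which anticommutes with `S ⊗ T` too, repairs the sign. -/
theorem parts_mem_commutant_tensorAlgebra {U : Grading H} {V : Grading K}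
    {M : VonNeumannAlgebra H} {N : VonNeumannAlgebra K} (hM : U.Preserves M) (hN : V.Preserves N)
    {X : HilbertTensor H K →L[ℂ] HilbertTensor H K} (hX : X ∈ (fermiProduct U V M N).commutant) :
    (U.tensorLeft K).evenPart X ∈ (tensorAlgebra M N).commutant ∧
      (U.tensorLeft K).oddPart X * (V.tensorRight H).op ∈ (tensorAlgebra M N).commutant := by
  set W := U.tensorLeft K
  obtain ⟨h1, h2⟩ := (mem_commutant_fermiProduct_iff hM hN).mp hX
  have g1 : ∀ S ∈ M, ∀ T ∈ N, V.op * T = T * V.op →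
      tensorOp S T * W.evenPart X = W.evenPart X * tensorOp S T ∧
      tensorOp S T * W.oddPart X = W.oddPart X * tensorOp S T := by
    refine fun S hS T hT hVT => W.commute_parts (h1 S hS T hT hVT) ?_
    rw [U.tensorLeft_op, tensorOp_mul, tensorOp_mul, one_mul, mul_one]
    exact h1 _ (hM.conj_mem hS) T hT hVT
  have g2 : ∀ S ∈ M, ∀ T ∈ N, V.op * T = -(T * V.op) →
      tensorOp (S * U.op) T * W.evenPart X = W.evenPart X * tensorOp (S * U.op) T ∧
      tensorOp (S * U.op) T * W.oddPart X = W.oddPart X * tensorOp (S * U.op) T := by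
    refine fun S hS T hT hVT => W.commute_parts (h2 S hS T hT hVT) ?_
    rw [U.tensorLeft_op, tensorOp_mul, tensorOp_mul, one_mul, mul_one, ← mul_assoc U.op]
    exact h2 _ (hM.conj_mem hS) T hT hVT
  have hfac : ∀ (S : H →L[ℂ] H) (T : K →L[ℂ] K),
      tensorOp S T = tensorOp (S * U.op) T * W.op := fun S T => by
    rw [U.tensorLeft_op, tensorOp_mul, mul_assoc, U.op_mul_op, mul_one, mul_one]
  simp only [mem_commutant_tensorAlgebra_iff]
  constructor
  · intro S hS T hT
    rw [tensorOp_eq_add_parts V, add_mul, mul_add,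
      (g1 S hS _ (hN.evenPart_mem hT) (V.op_mul_evenPart T)).1]
    congr 1
    rw [hfac, mul_assoc, W.op_mul_evenPart, ← mul_assoc,
      (g2 S hS _ (hN.oddPart_mem hT) (V.op_mul_oddPart T)).1, mul_assoc]
  · intro S hS T hT
    have c1 : tensorOp S (V.evenPart T) * (V.tensorRight H).op =
        (V.tensorRight H).op * tensorOp S (V.evenPart T) := by
      rw [V.tensorRight_op, tensorOp_mul, tensorOp_mul, V.op_mul_evenPart, one_mul, mul_one]
    have c2 : (V.tensorRight H).op * tensorOp S (V.oddPart T) =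
        -(tensorOp S (V.oddPart T) * (V.tensorRight H).op) := by
      rw [V.tensorRight_op, tensorOp_mul, tensorOp_mul, V.op_mul_oddPart, one_mul, mul_one,
        tensorOp_neg_right]
    have c3 : tensorOp S (V.oddPart T) * W.oddPart X =
        -(W.oddPart X * tensorOp S (V.oddPart T)) := by
      rw [hfac, mul_assoc, W.op_mul_oddPart, mul_neg, ← mul_assoc,
        (g2 S hS _ (hN.oddPart_mem hT) (V.op_mul_oddPart T)).2, mul_assoc]
    rw [tensorOp_eq_add_parts V, add_mul, mul_add, ← mul_assoc,
      (g1 S hS _ (hN.evenPart_mem hT) (V.op_mul_evenPart T)).2, mul_assoc, c1, mul_assoc,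
      mul_assoc, c2, ← mul_assoc (tensorOp S (V.oddPart T)), c3, neg_mul, mul_neg, mul_assoc]

/-- The mirror image, to be applied to `M'` and `N'`: for odd `S` one has `S ⊗ T = (1 ⊗ V)(S ⊗ V
T)`, and `U ⊗ 1` repairs the sign. -/
theorem parts_mem_commutant_tensorAlgebra_commutant {U : Grading H} {V : Grading K}
    {M : VonNeumannAlgebra H} {N : VonNeumannAlgebra K} (hM : U.Preserves M) (hN : V.Preserves N)
    {Y : HilbertTensor H K →L[ℂ] HilbertTensor H K}
    (hY : ∀ S ∈ M, ∀ T ∈ N, untwistedFermiOp U V S T * Y = Y * untwistedFermiOp U V S T) :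
    (V.tensorRight H).evenPart Y ∈ (tensorAlgebra M N).commutant ∧
      (U.tensorLeft K).op * (V.tensorRight H).oddPart Y ∈ (tensorAlgebra M N).commutant := by
  set W := V.tensorRight H
  have h1 : ∀ S ∈ M, U.op * S = S * U.op → ∀ T ∈ N, tensorOp S T * Y = Y * tensorOp S T := by
    intro S hS hUS T hT
    have := hY S hS T hT
    rwa [untwistedFermiOp, U.evenPart_of_comm hUS, U.oddPart_of_comm hUS, tensorOp_zero_left,
      add_zero] at this
  have h2 : ∀ S ∈ M, U.op * S = -(S * U.op) → ∀ T ∈ N,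
      tensorOp S (V.op * T) * Y = Y * tensorOp S (V.op * T) := by
    intro S hS hUS T hT
    have := hY S hS T hT
    rwa [untwistedFermiOp, U.evenPart_of_anticomm hUS, U.oddPart_of_anticomm hUS,
      tensorOp_zero_left, zero_add] at this
  have g1 : ∀ S ∈ M, U.op * S = S * U.op → ∀ T ∈ N,
      tensorOp S T * W.evenPart Y = W.evenPart Y * tensorOp S T ∧
      tensorOp S T * W.oddPart Y = W.oddPart Y * tensorOp S T := by
    refine fun S hS hUS T hT => W.commute_parts (h1 S hS hUS T hT) ?_
    rw [V.tensorRight_op, tensorOp_mul, tensorOp_mul, one_mul, mul_one]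
    exact h1 S hS hUS _ (hN.conj_mem hT)
  have g2 : ∀ S ∈ M, U.op * S = -(S * U.op) → ∀ T ∈ N,
      tensorOp S (V.op * T) * W.evenPart Y = W.evenPart Y * tensorOp S (V.op * T) ∧
      tensorOp S (V.op * T) * W.oddPart Y = W.oddPart Y * tensorOp S (V.op * T) := by
    refine fun S hS hUS T hT => W.commute_parts (h2 S hS hUS T hT) ?_
    rw [V.tensorRight_op, tensorOp_mul, tensorOp_mul, one_mul, mul_one, mul_assoc V.op]
    have := h2 S hS hUS _ (hN.conj_mem hT)
    rwa [mul_assoc V.op T] at this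
  have hfac : ∀ (S : H →L[ℂ] H) (T : K →L[ℂ] K),
      tensorOp S T = W.op * tensorOp S (V.op * T) := fun S T => by
    rw [V.tensorRight_op, tensorOp_mul, V.op_mul_op_mul, one_mul]
  simp only [mem_commutant_tensorAlgebra_iff]
  constructor
  · intro S hS T hT
    rw [tensorOp_eq_parts_add U, add_mul, mul_add,
      (g1 _ (hM.evenPart_mem hS) (U.op_mul_evenPart S) T hT).1]
    congr 1
    rw [hfac, mul_assoc, (g2 _ (hM.oddPart_mem hS) (U.op_mul_oddPart S) T hT).1, ← mul_assoc,
      W.op_mul_evenPart, mul_assoc]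
  · intro S hS T hT
    have c1 : tensorOp (U.evenPart S) T * (U.tensorLeft K).op =
        (U.tensorLeft K).op * tensorOp (U.evenPart S) T := by
      rw [U.tensorLeft_op, tensorOp_mul, tensorOp_mul, U.op_mul_evenPart, one_mul, mul_one]
    have c2 : tensorOp (U.oddPart S) T * (U.tensorLeft K).op =
        -((U.tensorLeft K).op * tensorOp (U.oddPart S) T) := by
      rw [U.tensorLeft_op, tensorOp_mul, tensorOp_mul, U.op_mul_oddPart, one_mul, mul_one,
        tensorOp_neg_left, neg_neg]
    have c3 : tensorOp (U.oddPart S) T * W.oddPart Y =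
        -(W.oddPart Y * tensorOp (U.oddPart S) T) := by
      rw [hfac, mul_assoc, (g2 _ (hM.oddPart_mem hS) (U.op_mul_oddPart S) T hT).2, ← mul_assoc,
        W.op_mul_oddPart, neg_mul, mul_assoc]
    rw [tensorOp_eq_parts_add U, add_mul, mul_add, ← mul_assoc, c1, mul_assoc,
      (g1 _ (hM.evenPart_mem hS) (U.op_mul_evenPart S) T hT).2, ← mul_assoc, ← mul_assoc, c2,
      neg_mul, mul_assoc (U.tensorLeft K).op (tensorOp (U.oddPart S) T), c3, mul_neg, neg_neg,
      ← mul_assoc]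

/-- The commutant of a Fermi product commutes with the commutant of the untwisted Fermi products. -/
theorem commute_of_mem_commutant_fermiProduct {U : Grading H} {V : Grading K}
    {M : VonNeumannAlgebra H} {N : VonNeumannAlgebra K} (hM : U.Preserves M) (hN : V.Preserves N)
    {X Y : HilbertTensor H K →L[ℂ] HilbertTensor H K} (hX : X ∈ (fermiProduct U V M N).commutant)
    (hY : ∀ S ∈ M.commutant, ∀ T ∈ N.commutant,
      untwistedFermiOp U V S T * Y = Y * untwistedFermiOp U V S T) :
    X * Y = Y * X := by
  set W₁ := U.tensorLeft K
  set W₂ := V.tensorRight H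
  obtain ⟨hA, hB⟩ := parts_mem_commutant_tensorAlgebra hM hN hX
  obtain ⟨hC, hF⟩ := parts_mem_commutant_tensorAlgebra_commutant hM.commutant hN.commutant hY
  have hw : W₁.op * W₂.op = W₂.op * W₁.op := by
    rw [U.tensorLeft_op, V.tensorRight_op, tensorOp_mul, tensorOp_mul]
    simp only [one_mul, mul_one]
  have hX' : X = W₁.evenPart X + W₁.oddPart X * W₂.op * W₂.op := by
    rw [mul_assoc, W₂.op_mul_op, mul_one, W₁.evenPart_add_oddPart]
  have hY' : Y = W₂.evenPart Y + W₁.op * (W₁.op * W₂.oddPart Y) := by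
    rw [W₁.op_mul_op_mul, W₂.evenPart_add_oddPart]
  rw [hX', hY']
  refine commute_of_graded_decomposition hw (W₁.op_mul_evenPart X) ?_ (W₂.op_mul_evenPart Y) ?_
    (commute_of_mem_commutant_tensorAlgebra hA hC) (commute_of_mem_commutant_tensorAlgebra hA hF)
    (commute_of_mem_commutant_tensorAlgebra hB hC) (commute_of_mem_commutant_tensorAlgebra hB hF)
  · rw [← mul_assoc, W₁.op_mul_oddPart, neg_mul, mul_assoc, hw, mul_assoc]
  · rw [← mul_assoc, ← hw, mul_assoc, W₂.op_mul_oddPart, mul_neg, mul_assoc]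

end Duality

end FermiProduct

theorem mainTheorem8
    {H : Type*} [NormedAddCommGroup H] [InnerProductSpace ℂ H] [CompleteSpace H]
    {K : Type*} [NormedAddCommGroup K] [InnerProductSpace ℂ K] [CompleteSpace K]
    (U : Grading H) (V : Grading K)
    (M : VonNeumannAlgebra H) (N : VonNeumannAlgebra K)
    (hM : U.Preserves M) (hN : V.Preserves N) :
    (U.tensor V).twistedCommutant (fermiProduct U V M N) =
      fermiProduct U V (U.twistedCommutant M) (V.twistedCommutant N) := by
  refine le_antisymm ?_ ?_
  · rintro _ ⟨X, hX, rfl⟩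
    rw [← SetLike.mem_coe, fermiProduct, coe_generated]
    intro Y hY
    rw [Grading.twist_eq]
    set φ := Unitary.conjStarAlgAut ℂ _ (U.tensor V).twistUnitary
    -- Pulled back along the twist, `Y` commutes with the untwisted operators.
    obtain ⟨Y, rfl⟩ : ∃ Z, φ Z = Y := φ.surjective Y
    rw [← map_mul, ← map_mul, commute_of_mem_commutant_fermiProduct hM hN hX]
    intro S hS T hT
    have := hY _ (Or.inl ⟨U.twist S, ⟨S, hS, rfl⟩, V.twist T, ⟨T, hT, rfl⟩, rfl⟩)
    rw [← twist_untwistedFermiOp, Grading.twist_eq, ← map_mul, ← map_mul] at this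
    exact φ.injective this
  · refine (generated_le_iff _ _).mpr ?_
    rintro _ ⟨_, ⟨S, hS, rfl⟩, _, ⟨T, hT, rfl⟩, rfl⟩
    exact ⟨_, untwistedFermiOp_mem_commutant hM hN hS hT, twist_untwistedFermiOp U V S T⟩
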